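/- **Theorem 2.** A dynamic graph on $n$ vertices starts empty and undergoes batches $B_1,\dots,B_t$; each $B_i$ is a non-empty set of new edges to insert or of existing edges to delete, and the arboricity $\max_{|S|\ge 2}\lceil |E(S)|/(|S|-1)\rceil$ is at most a known integer $c$ after every batch. Fix reals $\alpha>0$, $0<\epsilon\le 2$ and $\theta>2\alpha+2+\epsilon$. Put $\tau=\theta c$ (cutoff threshold) and $\tau'=(2+\epsilon)c$ (static threshold). *Algorithm.* For an insertion batch, direct the new edges arbitrarily and add them; let $E'$ be the set of all out-edges of the vertices that now have out-degree greater than $\tau$, and replace the directions of $E'$ by a static orientation of $E'$, computed in rounds: while edges are left, mark all vertices of remaining degree at most $\tau'$, direct every remaining edge with a marked endpoint out of a marked endpoint (out of the smaller one if both are marked), and remove these edges. For a deletion batch, delete the edges. Out-edges of each vertex are kept in a bag, so are the vertices of out-degree at most $\tau$ and those of out-degree greater than $\tau$, and grouping by vertex is done by a randomized semisort (random universal hashing). A flip is an edge whose direction is reversed by a static orientation step. Work is the number of executed instructions of a random-access machine that can draw uniform random integers. Let $t_{\rm ins}$ and $t_{\rm del}$ be the total numbers of inserted and deleted edges and let $r$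 be the total number of flips of the algorithm. There is a constant $K$ that depends only on $\alpha,\epsilon,\theta$ such that, for all $n$, $c$ and all such sequences of batches: 1. after every batch the algorithm stores (for every outcome of the random choices, and with directions that do not depend on them) an orientation of the current graph with all out-degrees at most $\tau+\tau'=(\theta+2+\epsilon)c$; 2. the expected total work is at most $K\,(t_{\rm ins}+t_{\rm del}+r)$, i.e. linear in the number of updates and flips; 3. for every online or offline strategy that, after each batch, holds an orientation of the current graph with out-degrees at most $\alpha c$, if $r^*$ is the total number of edges that it reverses from one batch to the next, then $r\le K\,(t_{\rm ins}+r^*)$; and if a unit of work of the strategy can insert, delete or reverse at most one edge and $W^*$ is its total work, then the expected total work of the algorithm is at most $K\,W^*$. In this sense the algorithm performs an optimal number of flips and runs in optimal expected work, up to constant factors. (For $\alpha=6/5$, $\epsilon=1/5$, $\theta=24/5$ it maintains a $7c$-orientation.) -/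

import Mathlib

open scoped ENNReal symmDiff

/-! ## Dynamic graphs

Vertices are the natural numbers below `n`.  An undirected graph is its finite set of edges; an
orientation is a finite set of ordered pairs, `(u, v)` standing for the edge directed `u → v`. -/

/-- The undirected edge underlying a directed edge. -/
def undirect (e : ℕ × ℕ) : Sym2 ℕ := s(e.1, e.2)

/-- Out-degree of `v` in a set of directed edges. -/
def outdeg (D : Finset (ℕ × ℕ)) (v : ℕ) : ℕ := (D.filter fun e => e.1 = v).card

/-- `D` gives each edge of `E` exactly one direction, and contains nothing else. -/
def IsOrientation (D : Finset (ℕ × ℕ)) (E : Finset (Sym2 ℕ)) : Prop :=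
  D.image undirect = E ∧ ∀ e ∈ D, e.swap ∉ D

/-- Arboricity of the graph with vertices `0, …, n - 1` and edges `E`: the maximum over vertex sets
`S` with at least two elements of `⌈|E(S)| / (|S| - 1)⌉`. -/
def arboricity (n : ℕ) (E : Finset (Sym2 ℕ)) : ℕ :=
  ((Finset.range n).powerset.filter fun S => 2 ≤ S.card).sup fun S =>
    ⌈((E ∩ S.sym2).card : ℚ) / ((S.card : ℚ) - 1)⌉₊

/-- A batch of edge insertions or of edge deletions.  For an insertion, the order in which the two
endpoints are listed is the (arbitrary) initial direction of the new edge; for a deletion it carries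
no information. -/
inductive Batch where
  | ins (B : List (ℕ × ℕ))
  | del (B : List (ℕ × ℕ))

namespace Batch

/-- The list of edges of a batch. -/
def edges : Batch → List (ℕ × ℕ)
  | ins B => B
  | del B => B

/-- Number of insertions in a batch. -/
def numIns : Batch → ℕ
  | ins B => B.length
  | del _ => 0

/-- Effect of a batch on the undirected graph. -/
def applyTo (E : Finset (Sym2 ℕ)) : Batch → Finset (Sym2 ℕ)
  | ins B => E ∪ (B.map undirect).toFinset
  | del B => E \ (B.map undirect).toFinset

/-- A legal batch for the graph `(n, E)`: non-empty, no loops, no repeated edges, inserting only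
absent edges or deleting only present ones. -/
def Legal (n : ℕ) (E : Finset (Sym2 ℕ)) (b : Batch) : Prop :=
  b.edges ≠ [] ∧ (b.edges.map undirect).Nodup ∧
  (∀ e ∈ b.edges, e.1 < n ∧ e.2 < n ∧ e.1 ≠ e.2) ∧
  match b with
  | ins B => ∀ e ∈ B, undirect e ∉ E
  | del B => ∀ e ∈ B, undirect e ∈ E

end Batch

/-- The graph after a sequence of batches, starting from the empty graph. -/
def graphAfter (seq : List Batch) : Finset (Sym2 ℕ) := seq.foldl Batch.applyTo ∅

/-- Total number of edge insertions of a sequence of batches. -/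
def totalIns (seq : List Batch) : ℕ := (seq.map Batch.numIns).sum

/-- Total number of edge insertions and deletions of a sequence of batches. -/
def totalUpdates (seq : List Batch) : ℕ := (seq.map fun b => b.edges.length).sum

/-- A sequence of legal batches along which the arboricity never exceeds `c`. -/
def ArboricityPreserving (n c : ℕ) (seq : List Batch) : Prop :=
  (∀ (i : ℕ) (h : i < seq.length), (seq[i]).Legal n (graphAfter (seq.take i))) ∧
  ∀ i ≤ seq.length, arboricity n (graphAfter (seq.take i)) ≤ c

/-! ## The algorithm, as a transformation of orientations

The thresholds are natural numbers: an out-degree exceeds a real number exactly when it exceeds its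
integer part. -/

/-- The rounds of the static orientation algorithm on a symmetric set `A` of directed edges: the
vertices of degree at most `s` are marked; an edge with a marked endpoint is directed out of it (out
of the smaller one if both are marked) and leaves `A`. -/
def peel (s : ℕ) : ℕ → Finset (ℕ × ℕ) → Finset (ℕ × ℕ)
  | 0, _ => ∅
  | k + 1, A =>
      (A.filter fun e => outdeg A e.1 ≤ s ∧ (¬ outdeg A e.2 ≤ s ∨ e.1 < e.2)) ∪
      peel s k (A.filter fun e => ¬ outdeg A e.1 ≤ s ∧ ¬ outdeg A e.2 ≤ s)

/-- Static orientation of the edges `E`.  Every round that marks a vertex removes an edge, so `|E|`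
rounds suffice unless the loop would run forever. -/
def staticOrientation (s : ℕ) (E : Finset (ℕ × ℕ)) : Finset (ℕ × ℕ) :=
  peel s E.card (E ∪ E.image Prod.swap)

/-- The edges of `D` leaving the vertices of out-degree greater than `T`. -/
def highEdges (T : ℕ) (D : Finset (ℕ × ℕ)) : Finset (ℕ × ℕ) :=
  D.filter fun e => T < outdeg D e.1

/-- One update, with cutoff threshold `T` and static threshold `s`: the new orientation, and the
number of edges whose direction the static orientation reverses. -/
def algStep (T s : ℕ) (D : Finset (ℕ × ℕ)) : Batch → Finset (ℕ × ℕ) × ℕ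
  | .ins B =>
      let D₁ := D ∪ B.toFinset
      let H := highEdges T D₁
      let F := staticOrientation s H
      ((D₁ \ H) ∪ F, (H \ F).card)
  | .del B => (D.filter fun e => undirect e ∉ B.map undirect, 0)

/-- Orientation and total number of flips after a sequence of batches. -/
def algRun (T s : ℕ) (seq : List Batch) : Finset (ℕ × ℕ) × ℕ :=
  seq.foldl (fun x b => ((algStep T s x.1 b).1, x.2 + (algStep T s x.1 b).2)) (∅, 0)

def algOrientation (T s : ℕ) (seq : List Batch) : Finset (ℕ × ℕ) := (algRun T s seq).1

def algFlips (T s : ℕ) (seq : List Batch) : ℕ := (algRun T s seq).2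

/-! ## Randomized random-access machine

Work is the number of instructions, whatever the schedule.  Local variables hold words (and `O(1)`
word operations are done along with each instruction) or arrays and linked lists; the latter are
only handled by the loops below, which charge for every element touched. -/

/-- Bags of vertices: the heads of the out-edges of `v`, and the two classes of vertices. -/
inductive BagId where
  | out (v : ℕ)
  | high
  | low
  deriving DecidableEq

/-- Memory cells that hold one word. -/
inductive Loc where
  /-- size of a bag -/
  | size (b : BagId)
  /-- `i`-th slot of a bag -/
  | item (b : BagId) (i : ℕ)
  /-- slot of a bag in which the element `x` lies -/
  | pos (b : BagId) (x : ℕ)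
  /-- part of the record of the edge `uv`: `1` if it is directed `u → v`, else `0` -/
  | dir (u v : ℕ)
  /-- `1` if `v` lies in the bag `high`, `0` if it lies in the bag `low` -/
  | isHigh (v : ℕ)
  /-- mark of a vertex in the static orientation -/
  | mark (v : ℕ)
  deriving DecidableEq

/-- Memory: word cells, and the table of the semisort, each of whose cells points to a linked list
of groups (a key with the list of its values). -/
structure Mem where
  word : Loc → ℕ
  bucket : ℕ → List (ℕ × List ℕ)

/-- Programs.  Every constructor but `ret` is one instruction. -/
inductive Prog (α : Type) : Type where
  | ret (a : α)
  | tick (k : Prog α)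
  | read (l : Loc) (k : ℕ → Prog α)
  | write (l : Loc) (x : ℕ) (k : Prog α)
  | readBucket (j : ℕ) (k : List (ℕ × List ℕ) → Prog α)
  | writeBucket (j : ℕ) (x : List (ℕ × List ℕ)) (k : Prog α)
  /-- draw an integer uniformly from `{0, …, r}` -/
  | rand (r : ℕ) (k : ℕ → Prog α)

namespace Prog

/-- Sequential composition. -/
def seqBind {α β : Type} : Prog α → (α → Prog β) → Prog β
  | ret a, f => f a
  | tick k, f => tick (k.seqBind f)
  | read l k, f => read l fun x => (k x).seqBind f
  | write l x k, f => write l x (k.seqBind f)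
  | readBucket j k, f => readBucket j fun x => (k x).seqBind f
  | writeBucket j x k, f => writeBucket j x (k.seqBind f)
  | rand r k, f => rand r fun x => (k x).seqBind f

instance : Monad Prog where
  pure := ret
  bind := seqBind

/-- Pay for one more instruction. -/
noncomputable def pay {α : Type} (μ : PMF (α × Mem × ℕ)) : PMF (α × Mem × ℕ) :=
  μ.map fun x => (x.1, x.2.1, x.2.2 + 1)

/-- Joint law of the result, the final memory and the number of executed instructions. -/
noncomputable def run {α : Type} : Prog α → Mem → PMF (α × Mem × ℕ)
  | ret a, m => PMF.pure (a, m, 0)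
  | tick k, m => pay (k.run m)
  | read l k, m => pay ((k (m.word l)).run m)
  | write l x k, m => pay (k.run { m with word := Function.update m.word l x })
  | readBucket j k, m => pay ((k (m.bucket j)).run m)
  | writeBucket j x k, m => pay (k.run { m with bucket := Function.update m.bucket j x })
  | rand r k, m => pay ((PMF.uniformOfFintype (Fin (r + 1))).bind fun i => (k i).run m)

/-- Expected number of instructions executed from memory `m`. -/
noncomputable def expectedWork {α : Type} (p : Prog α) (m : Mem) : ℝ≥0∞ :=
  ∑' x : α × Mem × ℕ, p.run m x * (x.2.2 : ℝ≥0∞)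

/-! ### Single instructions and loops over arrays -/

def step : Prog Unit := tick (ret ())

def get (l : Loc) : Prog ℕ := read l ret

def put (l : Loc) (x : ℕ) : Prog Unit := write l x (ret ())

def getBucket (j : ℕ) : Prog (List (ℕ × List ℕ)) := readBucket j ret

def putBucket (j : ℕ) (x : List (ℕ × List ℕ)) : Prog Unit := writeBucket j x (ret ())

def random (r : ℕ) : Prog ℕ := rand r ret

/-- `k` instructions. -/
def steps : ℕ → Prog Unit
  | 0 => pure ()
  | k + 1 => do step; steps k

/-- Execute `f` on all elements of an array: one instruction per element, besides those of `f`. -/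
def forEach {α : Type} (f : α → Prog Unit) : List α → Prog Unit
  | [] => pure ()
  | a :: t => do step; f a; forEach f t

/-- Concatenate the arrays computed by `f`: one instruction per element of the input and one per
element copied to the output, besides those of `f`. -/
def collect {α β : Type} (f : α → Prog (List β)) : List α → Prog (List β)
  | [] => pure []
  | a :: t => do
      step
      let x ← f a
      steps x.length
      let y ← collect f t
      pure (x ++ y)

/-- Filter an array: one instruction per element, besides those of `f`. -/
def select {α : Type} (f : α → Prog Bool) : List α → Prog (List α)
  | [] => pure []
  | a :: t => do
      step
      let b ← f a
      let y ← select f t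
      pure (if b then a :: y else y)

/-- Swap the entries of all pairs in an array. -/
def swapAll (A : List (ℕ × ℕ)) : Prog (List (ℕ × ℕ)) := collect (fun e => pure [e.swap]) A

/-! ### Bags -/

/-- Insert `x` into the bag `b`. -/
def bagInsert (b : BagId) (x : ℕ) : Prog Unit := do
  let k ← get (.size b)
  put (.item b k) x
  put (.pos b x) k
  put (.size b) (k + 1)

/-- Delete `x` from the bag `b`: the element of the last slot takes its place. -/
def bagDelete (b : BagId) (x : ℕ) : Prog Unit := do
  let i ← get (.pos b x)
  let k ← get (.size b)
  let y ← get (.item b (k - 1))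
  put (.item b i) y
  put (.pos b y) i
  put (.size b) (k - 1)

/-- The contents of the bag `b` as an array. -/
def bagPeek (b : BagId) : Prog (List ℕ) := do
  let k ← get (.size b)
  collect (fun i => do let x ← get (.item b i); pure [x]) (List.range k)

/-! ### Randomized semisort -/

/-- Add the value `v` to the group with key `k` in a linked list of groups, walking along the list
until the key is found. -/
def chainInsert (k v : ℕ) : List (ℕ × List ℕ) → Prog (List (ℕ × List ℕ))
  | [] => do step; pure [(k, [v])]
  | g :: t => do
      step
      if g.1 = k then pure ((k, v :: g.2) :: t)
      else
        let t₁ ← chainInsert k v t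
        pure (g :: t₁)

/-- Group an array of pairs by their first entries, the keys, which are smaller than the
prime `p`: the keys are hashed to as many buckets as there are pairs by
`x ↦ ((a x + b) mod p) mod |A|` with random `a`, `b`, and then the groups are read off. -/
def groupBy (p : ℕ) (A : List (ℕ × ℕ)) : Prog (List (ℕ × List ℕ)) := do
  let a ← random (p - 1)
  let b ← random (p - 1)
  forEach (fun j => putBucket j []) (List.range A.length)
  forEach (fun e => do
    let j := ((a * e.1 + b) % p) % A.length
    let g ← getBucket j
    let g₁ ← chainInsert e.1 e.2 g
    putBucket j g₁) A
  collect getBucket (List.range A.length)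

/-! ### Static orientation -/

/-- The loop of the static orientation on the array `A`, which holds every edge in both directions;
`F` is the output so far. -/
def peelLoop (p s : ℕ) : ℕ → List (ℕ × ℕ) → List (ℕ × ℕ) → Prog (List (ℕ × ℕ))
  | 0, _, F => do step; pure F
  | k + 1, A, F => do
      step
      if A = [] then pure F
      else
        let G ← groupBy p A
        forEach (fun g => do
          steps g.2.length
          if g.2.length ≤ s then put (.mark g.1) 1) G
        let N ← select (fun e => do
          let x ← get (.mark e.1)
          let y ← get (.mark e.2)
          pure (decide (x = 1 ∧ (y ≠ 1 ∨ e.1 < e.2)))) A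
        let R ← select (fun e => do
          let x ← get (.mark e.1)
          let y ← get (.mark e.2)
          pure (decide (x ≠ 1 ∧ y ≠ 1))) A
        forEach (fun g => put (.mark g.1) 0) G
        steps N.length
        peelLoop p s k R (N ++ F)

/-- Static orientation of the array `A` of edges. -/
def staticOrient (p s : ℕ) (A : List (ℕ × ℕ)) : Prog (List (ℕ × ℕ)) := do
  let A₂ ← collect (fun e => pure [e, e.swap]) A
  peelLoop p s A.length A₂ []

/-! ### Batch updates -/

/-- Move `u` to the bag `high` or `low` to which its out-degree assigns it. -/
def refresh (T u : ℕ) : Prog Unit := do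
  let d ← get (.size (.out u))
  let h ← get (.isHigh u)
  if T < d ∧ h = 0 then do
    bagDelete .low u
    bagInsert .high u
    put (.isHigh u) 1
  else if d ≤ T ∧ h ≠ 0 then do
    bagDelete .high u
    bagInsert .low u
    put (.isHigh u) 0
  else pure ()

/-- Semisort directed edges by their tails and add them to the bags of out-edges. -/
def addEdges (p T : ℕ) (A : List (ℕ × ℕ)) : Prog Unit := do
  let G ← groupBy p A
  forEach (fun g => do
    forEach (fun v => do bagInsert (.out g.1) v; put (.dir g.1 v) 1) g.2
    refresh T g.1) G

/-- Semisort directed edges by their tails and remove them from the bags of out-edges. -/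
def removeEdges (p T : ℕ) (A : List (ℕ × ℕ)) : Prog Unit := do
  let G ← groupBy p A
  forEach (fun g => do
    forEach (fun v => do bagDelete (.out g.1) v; put (.dir g.1 v) 0) g.2
    refresh T g.1) G

/-- Process one batch, with cutoff threshold `T` and static threshold `s`. -/
def update (p T s : ℕ) : Batch → Prog Unit
  | .ins B => do
      addEdges p T B
      let V ← bagPeek .high
      let H ← collect (fun u => do
        let X ← bagPeek (.out u)
        collect (fun v => pure [(u, v)]) X) V
      let F ← staticOrient p s H
      let X ← select (fun e => do
        let d ← get (.dir e.1 e.2)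
        pure (decide (d = 0))) F
      let Y ← swapAll X
      removeEdges p T Y
      addEdges p T X
  | .del B => do
      let X ← collect (fun e => do
        let d ← get (.dir e.1 e.2)
        pure [if d = 1 then e else e.swap]) B
      removeEdges p T X

/-- Process a sequence of batches. -/
def updateAll (p T s : ℕ) : List Batch → Prog Unit
  | [] => pure ()
  | b :: t => do update p T s b; updateAll p T s t

end Prog

/-- The least prime `p ≥ n`, fixed once and for all when the vertex array is set up. -/
def hashPrime (n : ℕ) : ℕ := Nat.find (Nat.exists_infinite_primes n)

namespace Mem

/-- Memory for the empty graph on `n` vertices: all vertices lie in the bag `low`. -/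
def init (n : ℕ) : Mem where
  word
    | .size .low => n
    | .item .low i => i
    | .pos .low x => x
    | _ => 0
  bucket _ := []

/-- The memory `m` holds the orientation `D`, both in the edge records and in the bags of
out-edges. -/
def Stores (m : Mem) (D : Finset (ℕ × ℕ)) : Prop :=
  ∀ u v : ℕ, ((u, v) ∈ D ↔ m.word (.dir u v) = 1) ∧
    ((u, v) ∈ D ↔ ∃ i < m.word (.size (.out u)), m.word (.item (.out u) i) = v) ∧
    m.word (.size (.out u)) = outdeg D u

end Mem

/-! ## Arbitrary strategies -/

/-- An arbitrary (online or offline) way to keep, for the sequence `seq`, an orientation with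
out-degrees at most `k`.  A unit of work changes the presence or the direction of at most one edge;
apart from this, a strategy may do anything, and between batches it need not respect the bound. -/
structure Strategy (seq : List Batch) (k : ℝ) where
  /-- what is stored after `j` units of work -/
  state : ℕ → Finset (ℕ × ℕ)
  /-- total work done when `i` batches have been processed -/
  time : ℕ → ℕ
  time_zero : time 0 = 0
  time_mono : Monotone time
  unit_work : ∀ j, ∃ a : Sym2 ℕ, ∀ e ∈ state j ∆ state (j + 1), undirect e = a
  orients : ∀ i ≤ seq.length, IsOrientation (state (time i)) (graphAfter (seq.take i))
  bounded : ∀ i ≤ seq.length, ∀ v, (outdeg (state (time i)) v : ℝ) ≤ k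

namespace Strategy

/-- Number of flips of a strategy: the edges whose directions before and after a batch differ,
summed over the batches. -/
def flips {seq : List Batch} {k : ℝ} (S : Strategy seq k) : ℕ :=
  ∑ i ∈ Finset.range seq.length,
    ((S.state (S.time i)).filter fun e => e.swap ∈ S.state (S.time (i + 1))).card

/-- Total work of a strategy. -/
def work {seq : List Batch} {k : ℝ} (S : Strategy seq k) : ℕ := S.time seq.length

end Strategy

/-!
The proof has three independent parts.

**Work.** `Prog.Spec` is a Hoare triple for randomized programs that also bounds the expected number
of instructions; by linearity of expectation such bounds add up under sequential composition.
Randomness enters only through the semisort: two distinct keys agree under the hash function for at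
most `p (⌊p / M⌋ + 1)` of its `p²` choices, so the chain along which an element walks has expected
length at most three (`sum_card_hash_bucket_le`), and grouping takes linear time
(`Prog.spec_groupBy`).  A round of the static orientation leaves only edges between vertices of
degree more than `(2 + ε) c`; as these span at most `c` edges per vertex, each round keeps at most a
fraction `2 / (2 + ε)` of the edges (`shrinks_of_arboricity_le`).  Hence the loop ends with all edges
directed, and its cost is a geometric sum (`Prog.spec_peelLoop`).  An update therefore costs
`O(|B| + |H|)`, where `H` is the set of edges given to the static orientation
(`Prog.spec_update`).

**Flips.** A vertex with more than `θ c` out-edges keeps at most `(2 + ε) c` of them, so a constant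
fraction of `H` is flipped (`staticSize_le`), and the work is linear in updates and flips.

**Competitiveness.** The potential is the number of edges directed differently from the strategy's
orientation (`disagreements`).  An insertion or a flip of the strategy raises it by at most one.  If
`v` vertices are high, then `|H| ≥ θ c v`; at least `|H| - α c v` edges of `H` disagree before the
static orientation step and at most `(2 + ε) c v + α c v` after it (`disagreements_replace_le`).
Since `θ > 2 α + 2 + ε`, the potential drops by a constant fraction of `|H|`, which pays for the
flips.  Finally, every update and every flip of the strategy takes one of its units of work
(`Strategy.totalUpdates_add_flips_le_work`).
-/

/-! ### Cost calculus for programs -/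

/-- The expectation of `g` under a `PMF.bind` is an iterated expectation. -/
theorem PMF.tsum_bind_mul {α β : Type*} (μ : PMF α) (κ : α → PMF β) (g : β → ℝ≥0∞) :
    ∑' y, (μ.bind κ) y * g y = ∑' x, μ x * ∑' y, κ x y * g y := by
  simp only [PMF.bind_apply, ← ENNReal.tsum_mul_right, ← ENNReal.tsum_mul_left]
  rw [ENNReal.tsum_comm]
  simp only [mul_assoc]

theorem PMF.tsum_pure_mul {α : Type*} (a : α) (g : α → ℝ≥0∞) :
    ∑' y, (PMF.pure a) y * g y = g a := by
  rw [tsum_eq_single a]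
  · simp
  · intro b hb
    simp [PMF.pure_apply, hb]

theorem PMF.tsum_map_mul {α β : Type*} (μ : PMF α) (f : α → β) (g : β → ℝ≥0∞) :
    ∑' y, (μ.map f) y * g y = ∑' x, μ x * g (f x) := by
  rw [← PMF.bind_pure_comp, PMF.tsum_bind_mul]
  simp only [Function.comp_apply, PMF.tsum_pure_mul]

namespace Prog

theorem tsum_pay {α : Type} (μ : PMF (α × Mem × ℕ)) :
    ∑' x : α × Mem × ℕ, pay μ x * (x.2.2 : ℝ≥0∞)
      = 1 + ∑' x : α × Mem × ℕ, μ x * (x.2.2 : ℝ≥0∞) := by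
  rw [pay, PMF.tsum_map_mul]
  simp only [Nat.cast_add, Nat.cast_one, mul_add, mul_one]
  rw [ENNReal.tsum_add, PMF.tsum_coe, add_comm]

theorem expectedWork_ret {α : Type} (a : α) (m : Mem) : (ret a).expectedWork m = 0 := by
  simp [expectedWork, run]

theorem expectedWork_tick {α : Type} (k : Prog α) (m : Mem) :
    (tick k).expectedWork m = 1 + k.expectedWork m := tsum_pay _

theorem expectedWork_read {α : Type} (l : Loc) (k : ℕ → Prog α) (m : Mem) :
    (read l k).expectedWork m = 1 + (k (m.word l)).expectedWork m := tsum_pay _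

theorem expectedWork_write {α : Type} (l : Loc) (x : ℕ) (k : Prog α) (m : Mem) :
    (write l x k).expectedWork m =
      1 + k.expectedWork { m with word := Function.update m.word l x } := tsum_pay _

theorem expectedWork_readBucket {α : Type} (j : ℕ) (k : List (ℕ × List ℕ) → Prog α) (m : Mem) :
    (readBucket j k).expectedWork m = 1 + (k (m.bucket j)).expectedWork m := tsum_pay _

theorem expectedWork_writeBucket {α : Type} (j : ℕ) (x : List (ℕ × List ℕ)) (k : Prog α)
    (m : Mem) :
    (writeBucket j x k).expectedWork m =
      1 + k.expectedWork { m with bucket := Function.update m.bucket j x } := tsum_pay _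

theorem expectedWork_rand {α : Type} (r : ℕ) (k : ℕ → Prog α) (m : Mem) :
    (rand r k).expectedWork m =
      1 + ∑ i : Fin (r + 1), ((r + 1 : ℕ) : ℝ≥0∞)⁻¹ * (k i).expectedWork m := by
  rw [expectedWork, run, tsum_pay, PMF.tsum_bind_mul, tsum_fintype]
  simp [expectedWork]

theorem support_pay {α : Type} (μ : PMF (α × Mem × ℕ)) (Q : α → Mem → Prop) :
    (∀ x ∈ (pay μ).support, Q x.1 x.2.1) ↔ ∀ x ∈ μ.support, Q x.1 x.2.1 := by
  simp only [pay, PMF.support_map, Set.forall_mem_image]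

theorem seqBind_assoc {α β γ : Type} (p : Prog α) (f : α → Prog β) (g : β → Prog γ) :
    (p.seqBind f).seqBind g = p.seqBind fun x => (f x).seqBind g := by
  induction p with
  | ret a => rfl
  | tick k ih => simp only [seqBind, ih]
  | read l k ih => simp only [seqBind, ih]
  | write l x k ih => simp only [seqBind, ih]
  | readBucket j k ih => simp only [seqBind, ih]
  | writeBucket j x k ih => simp only [seqBind, ih]
  | rand r k ih => simp only [seqBind, ih]

/-- `p.Spec m Q c`: started in memory `m`, the program `p` ends with a result and a memory that
satisfy `Q`, whatever the random choices, and executes at most `c` instructions in expectation. -/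
def Spec {α : Type} (p : Prog α) (m : Mem) (Q : α → Mem → Prop) (c : ℕ) : Prop :=
  (∀ x ∈ (p.run m).support, Q x.1 x.2.1) ∧ p.expectedWork m ≤ (c : ℝ≥0∞)

namespace Spec

variable {α β : Type} {m : Mem} {c d : ℕ}

theorem mono {p : Prog α} {Q R : α → Mem → Prop} (h : p.Spec m Q c)
    (hQ : ∀ a m', Q a m' → R a m') (hc : c ≤ d) : p.Spec m R d :=
  ⟨fun x hx => hQ _ _ (h.1 x hx), h.2.trans (by exact_mod_cast hc)⟩

theorem mono_cost {p : Prog α} {Q : α → Mem → Prop} (h : p.Spec m Q c) (hc : c ≤ d) :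
    p.Spec m Q d := h.mono (fun _ _ h => h) hc

theorem pure {a : α} {Q : α → Mem → Prop} (h : Q a m) : (Pure.pure a : Prog α).Spec m Q 0 := by
  refine ⟨?_, ?_⟩
  · intro x hx
    have : x = (a, m, 0) := by simpa [Pure.pure, run] using hx
    subst this; exact h
  · exact (expectedWork_ret a m).le.trans (by simp)

theorem of_pay {p p' : Prog α} {m' : Mem} {Q : α → Mem → Prop}
    (hrun : p.run m = pay (p'.run m')) (h : p'.Spec m' Q c) : p.Spec m Q (c + 1) := by
  refine ⟨?_, ?_⟩
  · rw [hrun, support_pay]; exact h.1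
  · rw [expectedWork, hrun, tsum_pay, add_comm, Nat.cast_add, Nat.cast_one]
    exact add_le_add_left h.2 1

theorem step_bind {f : Unit → Prog α} {Q : α → Mem → Prop} (h : (f ()).Spec m Q c) :
    (step >>= f).Spec m Q (c + 1) := of_pay rfl h

theorem get_bind {l : Loc} {f : ℕ → Prog α} {Q : α → Mem → Prop}
    (h : (f (m.word l)).Spec m Q c) : (get l >>= f).Spec m Q (c + 1) := of_pay rfl h

theorem put_bind {l : Loc} {x : ℕ} {f : Unit → Prog α} {Q : α → Mem → Prop}
    (h : (f ()).Spec { m with word := Function.update m.word l x } Q c) :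
    (put l x >>= f).Spec m Q (c + 1) := of_pay rfl h

theorem put {l : Loc} {x : ℕ} {Q : Unit → Mem → Prop}
    (h : Q () { m with word := Function.update m.word l x }) :
    (put l x).Spec m Q 1 := of_pay rfl (Spec.pure h)

theorem getBucket_bind {j : ℕ} {f : List (ℕ × List ℕ) → Prog α} {Q : α → Mem → Prop}
    (h : (f (m.bucket j)).Spec m Q c) : (getBucket j >>= f).Spec m Q (c + 1) := of_pay rfl h

theorem getBucket {j : ℕ} {Q : List (ℕ × List ℕ) → Mem → Prop} (h : Q (m.bucket j) m) :
    (getBucket j).Spec m Q 1 := of_pay rfl (Spec.pure h)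

theorem putBucket {j : ℕ} {x : List (ℕ × List ℕ)} {Q : Unit → Mem → Prop}
    (h : Q () { m with bucket := Function.update m.bucket j x }) :
    (putBucket j x).Spec m Q 1 := of_pay rfl (Spec.pure h)

theorem support_seqBind (p : Prog α) (f : α → Prog β) (Q : β → Mem → Prop) (m : Mem)
    (h : ∀ x ∈ (p.run m).support, ∀ y ∈ ((f x.1).run x.2.1).support, Q y.1 y.2.1) :
    ∀ y ∈ ((p.seqBind f).run m).support, Q y.1 y.2.1 := by
  have key : ∀ (P : α → Mem → Prop),
      (∀ a m', P a m' → ∀ y ∈ ((f a).run m').support, Q y.1 y.2.1) →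
      ∀ (p : Prog α) (m : Mem), (∀ x ∈ (p.run m).support, P x.1 x.2.1) →
        ∀ y ∈ ((p.seqBind f).run m).support, Q y.1 y.2.1 := by
    intro P hP p
    induction p with
    | ret a => intro m h; exact hP a m (h (a, m, 0) (by simp [run]))
    | tick k ih => intro m h; exact (support_pay _ Q).2 (ih m ((support_pay _ _).1 h))
    | read l k ih => intro m h; exact (support_pay _ Q).2 (ih _ m ((support_pay _ _).1 h))
    | write l x k ih => intro m h; exact (support_pay _ Q).2 (ih _ ((support_pay _ _).1 h))
    | readBucket j k ih => intro m h; exact (support_pay _ Q).2 (ih _ m ((support_pay _ _).1 h))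
    | writeBucket j x k ih => intro m h; exact (support_pay _ Q).2 (ih _ ((support_pay _ _).1 h))
    | rand r k ih =>
      intro m h
      have h := (support_pay _ P).1 h
      refine (support_pay _ Q).2 ?_
      intro y hy
      rw [PMF.mem_support_bind_iff] at hy
      obtain ⟨i, hi, hy⟩ := hy
      refine ih i m (fun x hx => h x ?_) y hy
      rw [PMF.mem_support_bind_iff]
      exact ⟨i, hi, hx⟩
  exact key (fun a m' => ∀ y ∈ ((f a).run m').support, Q y.1 y.2.1) (fun _ _ h => h) p m h

theorem expectedWork_seqBind_le (f : α → Prog β) (e : ℝ≥0∞) (P : α → Mem → Prop)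
    (hP : ∀ a m', P a m' → (f a).expectedWork m' ≤ e) (p : Prog α) :
    ∀ (m : Mem), (∀ x ∈ (p.run m).support, P x.1 x.2.1) →
      (p.seqBind f).expectedWork m ≤ p.expectedWork m + e := by
  induction p with
  | ret a =>
    intro m h
    rw [expectedWork_ret, zero_add]
    exact hP a m (h (a, m, 0) (by simp [run]))
  | tick k ih =>
    intro m h
    rw [seqBind, expectedWork_tick, expectedWork_tick, add_assoc]
    exact add_le_add_right (ih m ((support_pay _ _).1 h)) 1
  | read l k ih =>
    intro m h
    rw [seqBind, expectedWork_read, expectedWork_read, add_assoc]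
    exact add_le_add_right (ih _ m ((support_pay _ _).1 h)) 1
  | write l x k ih =>
    intro m h
    rw [seqBind, expectedWork_write, expectedWork_write, add_assoc]
    exact add_le_add_right (ih _ ((support_pay _ _).1 h)) 1
  | readBucket j k ih =>
    intro m h
    rw [seqBind, expectedWork_readBucket, expectedWork_readBucket, add_assoc]
    exact add_le_add_right (ih _ m ((support_pay _ _).1 h)) 1
  | writeBucket j x k ih =>
    intro m h
    rw [seqBind, expectedWork_writeBucket, expectedWork_writeBucket, add_assoc]
    exact add_le_add_right (ih _ ((support_pay _ _).1 h)) 1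
  | rand r k ih =>
    intro m h
    have h := (support_pay _ P).1 h
    rw [seqBind, expectedWork_rand, expectedWork_rand, add_assoc]
    refine add_le_add_right ?_ 1
    have : ∑ i : Fin (r + 1), ((r + 1 : ℕ) : ℝ≥0∞)⁻¹ * e = e := by
      rw [Finset.sum_const, Finset.card_univ, Fintype.card_fin, nsmul_eq_mul, ← mul_assoc,
        ENNReal.mul_inv_cancel (by simp) (by simp), one_mul]
    calc _ ≤ ∑ i : Fin (r + 1), ((r + 1 : ℕ) : ℝ≥0∞)⁻¹ * ((k i).expectedWork m + e) := by
          refine Finset.sum_le_sum fun i _ => mul_le_mul_right ?_ _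
          refine ih i m fun x hx => h x ?_
          rw [PMF.mem_support_bind_iff]
          exact ⟨i, by simp, hx⟩
      _ = _ := by
          simp only [mul_add, Finset.sum_add_distrib]
          rw [this]

/-- Sequential composition adds expected costs, provided that the second program has expected cost
at most `d` from every state in which the first one can end. -/
theorem bind {p : Prog α} {f : α → Prog β} {Q : α → Mem → Prop} {R : β → Mem → Prop}
    (hp : p.Spec m Q c) (hf : ∀ a m', Q a m' → (f a).Spec m' R d) :
    (p >>= f).Spec m R (c + d) := by
  refine ⟨support_seqBind p f R m fun x hx => (hf _ _ (hp.1 x hx)).1, ?_⟩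
  refine (expectedWork_seqBind_le f d Q (fun a m' h => (hf a m' h).2) p m hp.1).trans ?_
  rw [Nat.cast_add]
  exact add_le_add_left hp.2 _

/-- Two independent uniform draws: the expected cost is the average of the costs of the outcomes. -/
theorem random_random_bind {r r' : ℕ} {f : ℕ → ℕ → Prog α} {Q : α → Mem → Prop}
    (w : ℕ → ℕ → ℕ) (h : ∀ a b, a ≤ r → b ≤ r' → (f a b).Spec m Q (w a b))
    (hw : ∑ a ∈ Finset.range (r + 1), ∑ b ∈ Finset.range (r' + 1), w a b
      ≤ (r + 1) * (r' + 1) * c) :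
    (random r >>= fun a => random r' >>= fun b => f a b).Spec m Q (c + 2) := by
  change (rand r fun a => rand r' fun b => f a b).Spec m Q (c + 2)
  refine ⟨(support_pay _ _).2 ?_, ?_⟩
  · intro x hx
    rw [PMF.mem_support_bind_iff] at hx
    obtain ⟨a, -, hx⟩ := hx
    revert x
    refine (support_pay _ _).2 ?_
    intro x hx
    rw [PMF.mem_support_bind_iff] at hx
    obtain ⟨b, -, hx⟩ := hx
    exact (h a b (by omega) (by omega)).1 x hx
  · simp only [expectedWork_rand]
    have h1 : ∀ a : Fin (r + 1), (1 : ℝ≥0∞) + ∑ b : Fin (r' + 1),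
        ((r' + 1 : ℕ) : ℝ≥0∞)⁻¹ * (f a b).expectedWork m ≤
        1 + ((r' + 1 : ℕ) : ℝ≥0∞)⁻¹ * ((∑ b ∈ Finset.range (r' + 1), w a b : ℕ) : ℝ≥0∞) := by
      intro a
      refine add_le_add_right ?_ 1
      rw [← Finset.mul_sum, Nat.cast_sum, Finset.sum_range]
      exact mul_le_mul_right (Finset.sum_le_sum fun (b : Fin (r' + 1)) _ => (h a b (Nat.le_of_lt_succ a.2)
        (Nat.le_of_lt_succ b.2)).2) _
    have hone : ∀ k : ℕ, ((k + 1 : ℕ) : ℝ≥0∞)⁻¹ * ((k + 1 : ℕ) : ℝ≥0∞) = 1 := fun k =>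
      ENNReal.inv_mul_cancel (by simp) (by simp)
    calc _ ≤ (1 : ℝ≥0∞) + ∑ a : Fin (r + 1), ((r + 1 : ℕ) : ℝ≥0∞)⁻¹ * (1 +
          ((r' + 1 : ℕ) : ℝ≥0∞)⁻¹ * ((∑ b ∈ Finset.range (r' + 1), w a b : ℕ) : ℝ≥0∞)) := by
          exact add_le_add_right (Finset.sum_le_sum fun a _ => mul_le_mul_right (h1 a) _) 1
      _ = 2 + ((r + 1 : ℕ) : ℝ≥0∞)⁻¹ * (((r' + 1 : ℕ) : ℝ≥0∞)⁻¹ *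
          ((∑ a ∈ Finset.range (r + 1), ∑ b ∈ Finset.range (r' + 1), w a b : ℕ) : ℝ≥0∞)) := by
          rw [← Finset.mul_sum, Finset.sum_add_distrib, mul_add, ← Finset.mul_sum]
          rw [Finset.sum_const, Finset.card_univ, Fintype.card_fin, nsmul_eq_mul, mul_one, hone,
            ← add_assoc, one_add_one_eq_two, Nat.cast_sum (Finset.range (r + 1)),
            Finset.sum_range (fun a => ((∑ b ∈ Finset.range (r' + 1), w a b : ℕ) : ℝ≥0∞))]
      _ ≤ 2 + ((r + 1 : ℕ) : ℝ≥0∞)⁻¹ * (((r' + 1 : ℕ) : ℝ≥0∞)⁻¹ *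
          (((r + 1) * (r' + 1) * c : ℕ) : ℝ≥0∞)) := by
          gcongr
      _ = ((c + 2 : ℕ) : ℝ≥0∞) := by
          rw [Nat.cast_mul, Nat.cast_mul, mul_assoc, mul_left_comm (_)⁻¹ ((r + 1 : ℕ) : ℝ≥0∞),
            ← mul_assoc, hone, one_mul, ← mul_assoc, hone, one_mul]
          push_cast; ring

/-! ### Loops over arrays -/

theorem steps (Q : Unit → Mem → Prop) (h : Q () m) (k : ℕ) : (steps k).Spec m Q k := by
  induction k with
  | zero => exact Spec.pure h
  | succ k ih => exact Spec.step_bind ih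

/-- Loop rule: the invariant `I` speaks of the elements processed so far. -/
theorem forEach {f : α → Prog Unit} (I : List α → Mem → Prop) (w : α → ℕ) (l : List α)
    (h : ∀ pre a post m', l = pre ++ a :: post → I pre m' →
      (f a).Spec m' (fun _ m'' => I (pre ++ [a]) m'') (w a))
    (h0 : I [] m) :
    (forEach f l).Spec m (fun _ m' => I l m') (l.map fun a => w a + 1).sum := by
  have key : ∀ (t pre : List α) (m : Mem), l = pre ++ t → I pre m →
      (Prog.forEach f t).Spec m (fun _ m' => I l m') (t.map fun a => w a + 1).sum := by
    intro t
    induction t with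
    | nil => intro pre m hl hI; exact Spec.pure (by simpa [hl] using hI)
    | cons a t ih =>
      intro pre m hl hI
      have := Spec.step_bind (f := fun _ => f a >>= fun _ => Prog.forEach f t)
        (Spec.bind (h pre a t m hl hI) fun _ m' hI' => ih (pre ++ [a]) m' (by simp [hl]) hI')
      refine Spec.mono_cost this ?_
      simp only [List.map_cons, List.sum_cons]; omega
  exact key l [] m rfl h0

/-- Loop rule for a body that computes `g a` from memory without changing it. -/
theorem collect {f : α → Prog (List β)} (g : α → List β) (w : α → ℕ) (l : List α)
    (h : ∀ a ∈ l, (f a).Spec m (fun x m' => x = g a ∧ m' = m) (w a)) :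
    (collect f l).Spec m (fun x m' => x = l.flatMap g ∧ m' = m)
      (l.map fun a => w a + (g a).length + 1).sum := by
  induction l with
  | nil => exact Spec.pure ⟨rfl, rfl⟩
  | cons a t ih =>
    have := Spec.step_bind (f := fun _ => f a >>= fun x => Prog.steps x.length >>= fun _ =>
        Prog.collect f t >>= fun y => Pure.pure (x ++ y))
        (Q := fun x m' => x = (a :: t).flatMap g ∧ m' = m)
        (Spec.bind (h a (by simp)) (d := (g a).length +
          ((t.map fun a => w a + (g a).length + 1).sum + 0)) (by
          rintro x _ ⟨rfl, rfl⟩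
          refine Spec.bind (Spec.steps (fun _ m' => m' = _) rfl _) ?_
          rintro _ _ rfl
          refine Spec.bind (ih fun a ha => h a (by simp [ha])) ?_
          rintro y _ ⟨rfl, rfl⟩
          exact Spec.pure ⟨by simp, rfl⟩))
    refine Spec.mono_cost this ?_
    simp only [List.map_cons, List.sum_cons]; omega

theorem select {f : α → Prog Bool} (g : α → Bool) (w : ℕ) (l : List α)
    (h : ∀ a ∈ l, (f a).Spec m (fun x m' => x = g a ∧ m' = m) w) :
    (select f l).Spec m (fun x m' => x = l.filter g ∧ m' = m) ((w + 1) * l.length) := by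
  induction l with
  | nil => exact Spec.pure ⟨rfl, rfl⟩
  | cons a t ih =>
    have := Spec.step_bind (f := fun _ => f a >>= fun b =>
        Prog.select f t >>= fun y => Pure.pure (if b then a :: y else y))
        (Q := fun x m' => x = (a :: t).filter g ∧ m' = m)
        (Spec.bind (h a (by simp)) (d := (w + 1) * t.length + 0) (by
          rintro x _ ⟨rfl, rfl⟩
          refine Spec.bind (ih fun a ha => h a (by simp [ha])) ?_
          rintro y _ ⟨rfl, rfl⟩
          refine Spec.pure ⟨?_, rfl⟩
          rw [List.filter_cons]))
    refine Spec.mono_cost this ?_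
    simp only [List.length_cons]; ring_nf; omega

end Spec

theorem spec_swapAll (A : List (ℕ × ℕ)) (m : Mem) :
    (swapAll A).Spec m (fun x m' => x = A.map Prod.swap ∧ m' = m) (2 * A.length) := by
  refine Spec.mono (Spec.collect (fun e => [e.swap]) (fun _ => 0) A
    fun a _ => Spec.pure ⟨rfl, rfl⟩) ?_ ?_
  · rintro x m' ⟨rfl, rfl⟩
    exact ⟨by rw [List.map_eq_flatMap], rfl⟩
  · simp [mul_comm]

end Prog

/-! ### Randomized semisort -/

/-- Multiplicative hashing `x ↦ ((a x + b) mod p) mod M` into `M` buckets: over all `p²` choices of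
`(a, b)`, two distinct keys collide at most `p (⌊p / M⌋ + 1)` times.  The map from `(a, b)` to the
pair of the two hash values modulo `p` is injective, as two points determine a line. -/
theorem sum_hash_collisions_le {p M x y : ℕ} (hp : p.Prime) (hx : x < p) (hy : y < p)
    (hxy : x ≠ y) :
    ∑ a ∈ Finset.range p, ∑ b ∈ Finset.range p,
      (if ((a * x + b) % p) % M = ((a * y + b) % p) % M then 1 else 0) ≤ p * (p / M + 1) := by
  have : Fact p.Prime := ⟨hp⟩
  rw [← Finset.sum_product', ← Finset.card_filter]
  calc _ ≤ ((Finset.range p).sigma fun r =>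
        (Finset.range p).filter fun s => r % M = s % M).card := by
        refine Finset.card_le_card_of_injOn
          (fun q => ⟨(q.1 * x + q.2) % p, (q.1 * y + q.2) % p⟩) ?_ ?_
        · intro q hq
          simp only [Finset.coe_filter, Finset.mem_product, Finset.mem_range,
            Set.mem_ofPred_eq] at hq
          simp only [Finset.coe_sigma, Set.mem_sigma_iff, Finset.mem_coe, Finset.mem_range,
            Finset.mem_filter]
          exact ⟨Nat.mod_lt _ hp.pos, Nat.mod_lt _ hp.pos, hq.2⟩
        · rintro ⟨a, b⟩ hq ⟨a', b'⟩ hq' h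
          simp only [Finset.coe_filter, Finset.mem_product, Finset.mem_range,
            Set.mem_ofPred_eq] at hq hq'
          simp only [Sigma.mk.injEq, heq_eq_eq] at h
          have h1 := (ZMod.natCast_eq_natCast_iff' _ _ p).2 h.1
          have h2 := (ZMod.natCast_eq_natCast_iff' _ _ p).2 h.2
          push_cast at h1 h2
          have hne : (x : ZMod p) - y ≠ 0 := by
            intro h0
            have := (ZMod.natCast_eq_natCast_iff' x y p).1 (sub_eq_zero.1 h0)
            rw [Nat.mod_eq_of_lt hx, Nat.mod_eq_of_lt hy] at this
            exact hxy this
          have h3 : ((a : ZMod p) - a') * (x - y) = 0 := by linear_combination h1 - h2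
          have ha : (a : ZMod p) = a' := by
            rcases mul_eq_zero.1 h3 with h | h
            · exact sub_eq_zero.1 h
            · exact absurd h hne
          have hb : (b : ZMod p) = b' := by rw [ha] at h1; exact add_left_cancel h1
          have ha' := (ZMod.natCast_eq_natCast_iff' _ _ p).1 ha
          have hb' := (ZMod.natCast_eq_natCast_iff' _ _ p).1 hb
          rw [Nat.mod_eq_of_lt hq.1.1, Nat.mod_eq_of_lt hq'.1.1] at ha'
          rw [Nat.mod_eq_of_lt hq.1.2, Nat.mod_eq_of_lt hq'.1.2] at hb'
          rw [ha', hb']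
    _ ≤ ∑ r ∈ Finset.range p, (p / M + 1) := by
        rw [Finset.card_sigma]
        refine Finset.sum_le_sum fun r _ => ?_
        conv_rhs => rw [← Finset.card_range (p / M + 1)]
        refine Finset.card_le_card_of_injOn (fun s => s / M) ?_ ?_
        · intro s hs
          simp only [Finset.coe_filter, Finset.mem_range, Set.mem_ofPred_eq] at hs
          simp only [Finset.coe_range, Set.mem_Iio]
          exact Nat.lt_succ_of_le (Nat.div_le_div_right hs.1.le)
        · intro s hs t ht h
          simp only [Finset.coe_filter, Finset.mem_range, Set.mem_ofPred_eq] at hs ht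
          rw [← Nat.div_add_mod s M, ← Nat.div_add_mod t M, ← hs.2, ← ht.2]
          simp only at h
          rw [h]
    _ = p * (p / M + 1) := by simp

/-- Over all `p²` choices of the hash function, the keys of `S` hashed to the bucket of `x`: on
average there are at most three of them. -/
theorem sum_card_hash_bucket_le {p M x : ℕ} (hp : p.Prime) (hx : x < p) (S : Finset ℕ)
    (hS : ∀ k ∈ S, k < p) (hM : S.card ≤ M) :
    ∑ a ∈ Finset.range p, ∑ b ∈ Finset.range p,
      (S.filter fun k => ((a * k + b) % p) % M = ((a * x + b) % p) % M).card ≤ p * p * 3 := by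
  simp only [Finset.card_filter]
  have hcard : S.card ≤ p := by
    simpa using Finset.card_le_card (fun k hk => Finset.mem_range.2 (hS k hk) : S ⊆ Finset.range p)
  calc _ = ∑ k ∈ S, ∑ a ∈ Finset.range p, ∑ b ∈ Finset.range p,
        (if ((a * k + b) % p) % M = ((a * x + b) % p) % M then 1 else 0) := by
        symm
        rw [Finset.sum_comm]
        refine Finset.sum_congr rfl fun a _ => ?_
        rw [Finset.sum_comm]
    _ ≤ ∑ k ∈ S, ((if k = x then p * p else 0) + p * (p / M + 1)) := by
        refine Finset.sum_le_sum fun k hk => ?_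
        split_ifs with h
        · refine le_trans (b := p * p) ?_ (Nat.le_add_right _ _)
          calc _ ≤ ∑ a ∈ Finset.range p, ∑ b ∈ Finset.range p, 1 :=
                Finset.sum_le_sum fun a _ => Finset.sum_le_sum fun b _ => by split_ifs <;> simp
            _ = p * p := by simp
        · rw [zero_add]
          exact sum_hash_collisions_le hp (hS k hk) hx h
    _ ≤ p * p + S.card * (p * (p / M + 1)) := by
        rw [Finset.sum_add_distrib, Finset.sum_const, smul_eq_mul, Finset.sum_ite_eq']
        gcongr
        split_ifs <;> simp
    _ ≤ p * p + (p * p + p * p) := by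
        gcongr
        calc S.card * (p * (p / M + 1)) = p * (S.card * (p / M) + S.card) := by ring
          _ ≤ p * (p + p) := by
              gcongr
              exact (Nat.mul_le_mul_right _ hM).trans (Nat.mul_div_le p M)
          _ = p * p + p * p := by ring
    _ = p * p * 3 := by ring

theorem sum_sum_list_sum_le {α : Type*} (I J : Finset ℕ) (w : ℕ → ℕ → α → ℕ) (C : ℕ) (l : List α)
    (h : ∀ e ∈ l, ∑ a ∈ I, ∑ b ∈ J, w a b e ≤ C) :
    ∑ a ∈ I, ∑ b ∈ J, (l.map (w a b)).sum ≤ l.length * C := by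
  induction l with
  | nil => simp
  | cons e t ih =>
    simp only [List.map_cons, List.sum_cons, Finset.sum_add_distrib, List.length_cons]
    have h1 := h e (by simp)
    have h2 := ih fun e he => h e (by simp [he])
    rw [add_mul, one_mul, add_comm]
    exact add_le_add h2 h1

/-- The pairs of key and value that a list of groups stands for. -/
def ungroup (G : List (ℕ × List ℕ)) : List (ℕ × ℕ) := G.flatMap fun g => g.2.map (Prod.mk g.1)

/-- `G` is the list `A` of pairs grouped by first entries, in any order. -/
structure IsGrouping (G : List (ℕ × List ℕ)) (A : List (ℕ × ℕ)) : Prop where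
  nodup : (G.map Prod.fst).Nodup
  ne_nil : ∀ g ∈ G, g.2 ≠ []
  perm : (ungroup G).Perm A

namespace IsGrouping

variable {G : List (ℕ × List ℕ)} {A : List (ℕ × ℕ)}

theorem mem_iff (h : IsGrouping G A) (u v : ℕ) : (u, v) ∈ A ↔ ∃ g ∈ G, g.1 = u ∧ v ∈ g.2 := by
  rw [← h.perm.mem_iff, ungroup, List.mem_flatMap]
  constructor
  · rintro ⟨g, hg, hv⟩
    obtain ⟨w, hw, he⟩ := List.mem_map.1 hv
    simp only [Prod.mk.injEq] at he
    exact ⟨g, hg, he.1, he.2 ▸ hw⟩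
  · rintro ⟨g, hg, rfl, hv⟩
    exact ⟨g, hg, List.mem_map.2 ⟨v, hv, rfl⟩⟩

theorem exists_mem_of_key (h : IsGrouping G A) {g : ℕ × List ℕ} (hg : g ∈ G) :
    ∃ e ∈ A, e.1 = g.1 := by
  obtain ⟨v, hv⟩ := List.exists_mem_of_ne_nil _ (h.ne_nil g hg)
  exact ⟨(g.1, v), (h.mem_iff _ _).2 ⟨g, hg, rfl, hv⟩, rfl⟩

theorem length_le_card_keys (h : IsGrouping G A) :
    G.length ≤ (A.map Prod.fst).toFinset.card := by
  rw [← List.length_map (f := Prod.fst), ← List.toFinset_card_of_nodup h.nodup]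
  refine Finset.card_le_card fun k hk => ?_
  simp only [List.mem_toFinset, List.mem_map] at hk ⊢
  obtain ⟨g, hg, rfl⟩ := hk
  exact h.exists_mem_of_key hg

theorem length_le (h : IsGrouping G A) : G.length ≤ A.length :=
  h.length_le_card_keys.trans ((List.toFinset_card_le _).trans (by simp))

theorem sum_length (h : IsGrouping G A) : (G.map fun g => g.2.length).sum = A.length := by
  rw [← h.perm.length_eq, ungroup, List.length_flatMap]
  simp

theorem group_nodup (h : IsGrouping G A) (hA : A.Nodup) {g : ℕ × List ℕ} (hg : g ∈ G) :
    g.2.Nodup := by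
  have h1 := h.perm.nodup_iff.2 hA
  rw [ungroup, List.nodup_flatMap] at h1
  exact (h1.1 g hg).of_map _

theorem eq_of_key_eq (h : IsGrouping G A) {g g' : ℕ × List ℕ} (hg : g ∈ G) (hg' : g' ∈ G)
    (hk : g.1 = g'.1) : g = g' :=
  List.inj_on_of_nodup_map h.nodup hg hg' hk

theorem mem_group_iff (h : IsGrouping G A) {g : ℕ × List ℕ} (hg : g ∈ G) (v : ℕ) :
    v ∈ g.2 ↔ (g.1, v) ∈ A := by
  rw [h.mem_iff]
  constructor
  · intro hv; exact ⟨g, hg, rfl, hv⟩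
  · rintro ⟨g', hg', hk, hv⟩
    rwa [h.eq_of_key_eq hg' hg hk] at hv

theorem length_group (h : IsGrouping G A) (hA : A.Nodup) {g : ℕ × List ℕ} (hg : g ∈ G) :
    g.2.length = outdeg A.toFinset g.1 := by
  rw [← List.toFinset_card_of_nodup (h.group_nodup hA hg), outdeg]
  refine Finset.card_bij (fun v _ => (g.1, v)) ?_ ?_ ?_
  · intro v hv
    rw [List.mem_toFinset, h.mem_group_iff hg] at hv
    simp [hv]
  · intro v _ v' _ hvv
    simpa using hvv
  · rintro ⟨u, v⟩ he
    simp only [Finset.mem_filter, List.mem_toFinset] at he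
    obtain ⟨he, rfl⟩ := he
    exact ⟨v, by rw [List.mem_toFinset, h.mem_group_iff hg]; exact he, rfl⟩

end IsGrouping

/-- The list of groups that `Prog.chainInsert` computes. -/
def chainAdd (k v : ℕ) : List (ℕ × List ℕ) → List (ℕ × List ℕ)
  | [] => [(k, [v])]
  | g :: t => if g.1 = k then (k, v :: g.2) :: t else g :: chainAdd k v t

theorem mem_keys_chainAdd {k v x : ℕ} {L : List (ℕ × List ℕ)} :
    x ∈ (chainAdd k v L).map Prod.fst ↔ x = k ∨ x ∈ L.map Prod.fst := by
  induction L with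
  | nil => simp [chainAdd]
  | cons g t ih =>
    rw [chainAdd]
    split_ifs with h
    · simp only [List.map_cons, List.mem_cons, h]; tauto
    · simp only [List.map_cons, List.mem_cons, ih]; tauto

theorem IsGrouping.nil : IsGrouping [] [] := ⟨by simp, by simp, by simp [ungroup]⟩

theorem IsGrouping.chainAdd {L : List (ℕ × List ℕ)} {A : List (ℕ × ℕ)} (h : IsGrouping L A)
    (k v : ℕ) : IsGrouping (chainAdd k v L) (A ++ [(k, v)]) := by
  refine ⟨?_, ?_, ?_⟩
  · have := h.nodup
    clear h
    induction L with
    | nil => simp [_root_.chainAdd]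
    | cons g t ih =>
      rw [List.map_cons, List.nodup_cons] at this
      rw [_root_.chainAdd]
      split_ifs with hk
      · rw [List.map_cons, List.nodup_cons]; exact hk ▸ this
      · rw [List.map_cons, List.nodup_cons, mem_keys_chainAdd]
        exact ⟨not_or.2 ⟨hk, this.1⟩, ih this.2⟩
  · have := h.ne_nil
    clear h
    induction L with
    | nil => simp [_root_.chainAdd]
    | cons g t ih =>
      rw [List.forall_mem_cons] at this
      rw [_root_.chainAdd]
      split_ifs with hk
      · rw [List.forall_mem_cons]; exact ⟨by simp, this.2⟩
      · rw [List.forall_mem_cons]; exact ⟨this.1, ih this.2⟩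
  · refine List.Perm.trans ?_ (List.perm_append_comm (l₁ := [(k, v)]))
    refine List.Perm.trans ?_ (List.Perm.append_left _ h.perm)
    clear h
    induction L with
    | nil => simp [_root_.chainAdd, ungroup]
    | cons g t ih =>
      rw [_root_.chainAdd]
      split_ifs with hk
      · subst hk; simp [ungroup]
      · have : ungroup (g :: _root_.chainAdd k v t) =
            g.2.map (Prod.mk g.1) ++ ungroup (_root_.chainAdd k v t) := by simp [ungroup]
        rw [this]
        refine (List.Perm.append_left _ ih).trans ?_
        have : ungroup (g :: t) = g.2.map (Prod.mk g.1) ++ ungroup t := by simp [ungroup]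
        rw [this]
        exact List.perm_middle

/-- Groupings of the parts of `A` that are hashed to the buckets `0, …, M - 1` combine to a grouping
of `A`. -/
theorem IsGrouping.flatMap_range {A : List (ℕ × ℕ)} (h : ℕ → ℕ) (M : ℕ)
    (hM : ∀ e ∈ A, h e.1 < M) (B : ℕ → List (ℕ × List ℕ))
    (hB : ∀ j < M, IsGrouping (B j) (A.filter fun e => h e.1 = j)) :
    IsGrouping ((List.range M).flatMap B) A := by
  refine ⟨?_, ?_, ?_⟩
  · rw [List.map_flatMap, List.nodup_flatMap]
    refine ⟨fun j hj => (hB j (List.mem_range.1 hj)).nodup, ?_⟩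
    refine List.Pairwise.imp_of_mem ?_ (List.nodup_range (n := M))
    intro i j hi hj hij k hki hkj
    obtain ⟨g, hg, rfl⟩ := List.mem_map.1 hki
    obtain ⟨g', hg', hk⟩ := List.mem_map.1 hkj
    obtain ⟨e, he, hek⟩ := (hB i (List.mem_range.1 hi)).exists_mem_of_key hg
    obtain ⟨e', he', hek'⟩ := (hB j (List.mem_range.1 hj)).exists_mem_of_key hg'
    simp only [List.mem_filter, decide_eq_true_eq] at he he'
    exact hij (by rw [← he.2, ← he'.2, hek, hek', hk])
  · intro g hg
    obtain ⟨j, hj, hg⟩ := List.mem_flatMap.1 hg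
    exact (hB j (List.mem_range.1 hj)).ne_nil g hg
  · have h1 : ∀ N ≤ M, (ungroup ((List.range N).flatMap B)).Perm
        (A.filter fun e => h e.1 < N) := by
      intro N
      induction N with
      | zero => intro _; simp [ungroup]
      | succ N ih =>
        intro hN
        have hsplit : ungroup ((List.range (N + 1)).flatMap B) =
            ungroup ((List.range N).flatMap B) ++ ungroup (B N) := by
          rw [List.range_succ, List.flatMap_append, ungroup, List.flatMap_append]
          simp [ungroup]
        rw [hsplit]
        refine ((ih (by omega)).append (hB N (by omega)).perm).trans ?_
        · have := List.filter_append_perm (fun e : ℕ × ℕ => decide (h e.1 < N))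
            (A.filter fun e => h e.1 < N + 1)
          rw [List.filter_filter, List.filter_filter] at this
          refine List.Perm.trans (List.Perm.of_eq ?_) this
          congr 1
          · refine List.filter_congr fun e _ => ?_
            simp only [← Bool.decide_and, decide_eq_decide]; omega
          · refine List.filter_congr fun e _ => ?_
            rw [← decide_not, ← Bool.decide_and, decide_eq_decide]; omega
    have h2 := h1 M le_rfl
    rwa [List.filter_eq_self.2 fun e he => decide_eq_true (hM e he)] at h2

namespace Prog

theorem spec_chainInsert (k v : ℕ) (m : Mem) (L : List (ℕ × List ℕ)) :
    (chainInsert k v L).Spec m (fun x m' => x = chainAdd k v L ∧ m' = m) (L.length + 1) := by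
  induction L with
  | nil => exact Spec.step_bind (Spec.pure ⟨rfl, rfl⟩)
  | cons g t ih =>
    rw [chainInsert]
    refine Spec.step_bind ?_
    rw [chainAdd]
    split_ifs with h
    · exact (Spec.pure ⟨rfl, rfl⟩).mono_cost (Nat.zero_le _)
    · refine (Spec.bind ih (d := 0) ?_)
      rintro x _ ⟨rfl, rfl⟩
      exact Spec.pure ⟨rfl, rfl⟩

/-- The semisort groups its input, changes only the table of buckets, and takes linear time in
expectation, as the expected length of the chain that an element walks along is at most `3`. -/
theorem spec_groupBy {p : ℕ} (hp : p.Prime) (A : List (ℕ × ℕ)) (hA : ∀ e ∈ A, e.1 < p) (m : Mem) :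
    (groupBy p A).Spec m (fun G m' => m'.word = m.word ∧ IsGrouping G A) (12 * A.length + 2) := by
  obtain ⟨q, rfl⟩ : ∃ q, p = q + 1 := ⟨p - 1, by have := hp.pos; omega⟩
  set S := (A.map Prod.fst).toFinset with hS
  have hScard : S.card ≤ A.length := (List.toFinset_card_le _).trans (by simp)
  have hSlt : ∀ k ∈ S, k < q + 1 := by
    intro k hk
    simp only [hS, List.mem_toFinset, List.mem_map] at hk
    obtain ⟨e, he, rfl⟩ := hk
    exact hA e he
  let H : ℕ → ℕ → ℕ → ℕ := fun a b x => ((a * x + b) % (q + 1)) % A.length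
  refine Spec.random_random_bind (fun a b =>
    (A.map fun e => (S.filter fun k => H a b k = H a b e.1).card).sum + 9 * A.length) ?_ ?_
  · intro a b _ _
    refine Spec.mono_cost (c := ((List.range A.length).map fun _ => 1 + 1).sum +
      ((A.map fun e => (S.filter fun k => H a b k = H a b e.1).card + 3 + 1).sum +
        3 * A.length)) ?_ ?_
    · refine Spec.bind (Spec.forEach (m := m)
        (fun pre m' => m'.word = m.word ∧ ∀ j ∈ pre, m'.bucket j = []) (fun _ => 1) _ ?_
        ⟨rfl, by simp⟩) ?_
      · rintro pre j post m' - ⟨hw, hb⟩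
        refine Spec.putBucket ⟨hw, ?_⟩
        intro i hi
        by_cases hij : i = j
        · simp [hij]
        · simp only [List.mem_append, List.mem_singleton, hij, or_false] at hi
          simpa [hij] using hb i hi
      rintro - m₁ ⟨hw₁, hb₁⟩
      refine Spec.bind (Spec.forEach
        (fun pre m' => m'.word = m.word ∧
          ∀ j < A.length, IsGrouping (m'.bucket j) (pre.filter fun e => H a b e.1 = j))
        (fun e => (S.filter fun k => H a b k = H a b e.1).card + 3) A ?_ ⟨hw₁, ?_⟩) ?_
      · rintro pre e post m' hpre ⟨hw, hb⟩
        have hj : H a b e.1 < A.length := Nat.mod_lt _ (by rw [hpre]; simp)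
        have hlen : (m'.bucket (H a b e.1)).length ≤
            (S.filter fun k => H a b k = H a b e.1).card := by
          refine (hb _ hj).length_le_card_keys.trans (Finset.card_le_card fun k hk => ?_)
          simp only [List.mem_toFinset, List.mem_map, List.mem_filter, decide_eq_true_eq] at hk
          obtain ⟨e', ⟨he', hh⟩, rfl⟩ := hk
          simp only [Finset.mem_filter, hS, List.mem_toFinset]
          exact ⟨List.mem_map_of_mem (by rw [hpre]; simp [he']), hh⟩
        refine Spec.mono_cost (c := ((m'.bucket (H a b e.1)).length + 1 + 1) + 1) ?_ (by omega)
        refine Spec.getBucket_bind (Spec.bind (d := 1) (spec_chainInsert _ _ _ _) ?_)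
        rintro _ m'' ⟨rfl, rfl⟩
        refine Spec.putBucket ⟨hw, fun j hj' => ?_⟩
        by_cases hjj : H a b e.1 = j
        · subst hjj
          have : (pre ++ [e]).filter (fun e' => decide (H a b e'.1 = H a b e.1)) =
              pre.filter (fun e' => decide (H a b e'.1 = H a b e.1)) ++ [e] := by
            simp [List.filter_append]
          rw [this]
          simpa [H] using (hb _ hj).chainAdd e.1 e.2
        · have : (pre ++ [e]).filter (fun e' => decide (H a b e'.1 = j)) =
              pre.filter (fun e' => decide (H a b e'.1 = j)) := by
            simp [List.filter_append, hjj]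
          rw [this]
          change IsGrouping (Function.update m''.bucket (H a b e.1) _ j) _
          rw [Function.update_of_ne (Ne.symm hjj)]
          exact hb j hj'
      · intro j hj
        rw [hb₁ j (List.mem_range.2 hj)]
        exact IsGrouping.nil
      rintro - m₂ ⟨hw₂, hb₂⟩
      have hG : IsGrouping ((List.range A.length).flatMap m₂.bucket) A :=
        IsGrouping.flatMap_range (H a b) A.length
          (fun e he => Nat.mod_lt _ (List.length_pos_of_mem he)) _ hb₂
      refine Spec.mono (Spec.collect m₂.bucket (fun _ => 1) _
        fun j _ => Spec.getBucket ⟨rfl, rfl⟩) ?_ ?_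
      · rintro _ _ ⟨rfl, rfl⟩
        exact ⟨hw₂, hG⟩
      · have h1 := hG.length_le
        rw [List.length_flatMap] at h1
        simp only [List.sum_map_add, List.map_const', List.sum_replicate, List.length_range,
          smul_eq_mul]
        omega
    · simp only [List.sum_map_add, List.map_const', List.sum_replicate, List.length_range,
        smul_eq_mul]
      omega
  · have h1 := sum_sum_list_sum_le (Finset.range (q + 1)) (Finset.range (q + 1))
      (fun a b (e : ℕ × ℕ) => (S.filter fun k => H a b k = H a b e.1).card) _ A
      (fun e he => sum_card_hash_bucket_le hp (hA e he) S hSlt hScard)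
    simp only [Finset.sum_add_distrib, Finset.sum_const, Finset.card_range, smul_eq_mul,
      Nat.add_sub_cancel]
    refine (add_le_add_left h1 _).trans (le_of_eq ?_)
    ring

end Prog

/-! ### Static orientation by peeling -/

theorem outdeg_mono {A B : Finset (ℕ × ℕ)} (h : A ⊆ B) (v : ℕ) : outdeg A v ≤ outdeg B v :=
  Finset.card_le_card (Finset.filter_subset_filter _ h)

theorem outdeg_union_le (A B : Finset (ℕ × ℕ)) (v : ℕ) :
    outdeg (A ∪ B) v ≤ outdeg A v + outdeg B v := by
  rw [outdeg, Finset.filter_union]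
  exact Finset.card_union_le _ _

theorem outdeg_eq_zero {A : Finset (ℕ × ℕ)} {v : ℕ} (h : ∀ e ∈ A, e.1 ≠ v) : outdeg A v = 0 := by
  rw [outdeg, Finset.card_eq_zero, Finset.filter_eq_empty_iff]
  exact fun e he => h e he

theorem undirect_swap (e : ℕ × ℕ) : undirect e.swap = undirect e := Sym2.eq_swap

theorem undirect_eq_iff {e f : ℕ × ℕ} : undirect e = undirect f ↔ e = f ∨ e = f.swap := by
  rw [undirect, undirect, Sym2.eq_iff, Prod.ext_iff, Prod.ext_iff]
  rfl

/-- The edges that one round of the static orientation removes, with their new directions. -/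
def peelOut (s : ℕ) (A : Finset (ℕ × ℕ)) : Finset (ℕ × ℕ) :=
  A.filter fun e => outdeg A e.1 ≤ s ∧ (¬ outdeg A e.2 ≤ s ∨ e.1 < e.2)

/-- The edges that are left after one round of the static orientation. -/
def peelRest (s : ℕ) (A : Finset (ℕ × ℕ)) : Finset (ℕ × ℕ) :=
  A.filter fun e => ¬ outdeg A e.1 ≤ s ∧ ¬ outdeg A e.2 ≤ s

theorem peel_succ (s k : ℕ) (A : Finset (ℕ × ℕ)) :
    peel s (k + 1) A = peelOut s A ∪ peel s k (peelRest s A) := rfl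

theorem peelRest_subset (s : ℕ) (A : Finset (ℕ × ℕ)) : peelRest s A ⊆ A := Finset.filter_subset _ _

theorem peel_subset (s k : ℕ) (A : Finset (ℕ × ℕ)) : peel s k A ⊆ A := by
  induction k generalizing A with
  | zero => simp [peel]
  | succ k ih =>
    rw [peel_succ]
    exact Finset.union_subset (Finset.filter_subset _ _) ((ih _).trans (peelRest_subset s A))

theorem peel_empty (s k : ℕ) : peel s k ∅ = ∅ := Finset.subset_empty.1 (peel_subset s k ∅)

/-- A vertex receives all its out-edges in the round that marks it, when its degree is at most
`s`. -/
theorem outdeg_peel_le (s k : ℕ) (A : Finset (ℕ × ℕ)) (v : ℕ) : outdeg (peel s k A) v ≤ s := by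
  induction k generalizing A with
  | zero => simp [peel, outdeg]
  | succ k ih =>
    rw [peel_succ]
    refine (outdeg_union_le _ _ v).trans ?_
    by_cases hv : outdeg A v ≤ s
    · have h0 : outdeg (peel s k (peelRest s A)) v = 0 := by
        refine outdeg_eq_zero fun e he hev => ?_
        have := (Finset.mem_filter.1 (peel_subset _ _ _ he)).2.1
        exact this (hev ▸ hv)
      rw [h0, add_zero]
      exact (outdeg_mono (Finset.filter_subset _ _) v).trans hv
    · have h0 : outdeg (peelOut s A) v = 0 := by
        refine outdeg_eq_zero fun e he hev => ?_
        exact hv (hev ▸ (Finset.mem_filter.1 he).2.1)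
      rw [h0, zero_add]
      exact ih _

theorem swap_notMem_peel (s k : ℕ) (A : Finset (ℕ × ℕ)) :
    ∀ e ∈ peel s k A, e.swap ∉ peel s k A := by
  induction k generalizing A with
  | zero => simp [peel]
  | succ k ih =>
    have hmix : ∀ e ∈ peelOut s A, e.swap ∉ peel s k (peelRest s A) := by
      intro e he hs
      have h1 := (Finset.mem_filter.1 he).2.1
      exact (Finset.mem_filter.1 (peel_subset _ _ _ hs)).2.2 h1
    intro e he hs
    rw [peel_succ, Finset.mem_union] at he hs
    rcases he with he | he <;> rcases hs with hs | hs
    · have h1 := (Finset.mem_filter.1 he).2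
      have h2 := (Finset.mem_filter.1 hs).2
      simp only [Prod.fst_swap, Prod.snd_swap] at h2
      rcases h1.2 with h | h
      · exact h h2.1
      · rcases h2.2 with h' | h'
        · exact h' h1.1
        · omega
    · exact hmix e he hs
    · exact hmix e.swap hs (by simpa using he)
    · exact ih _ e he hs

/-- `A` contains every edge in both directions. -/
def SwapClosed (A : Finset (ℕ × ℕ)) : Prop := ∀ e ∈ A, e.swap ∈ A

theorem SwapClosed.peelRest {A : Finset (ℕ × ℕ)} (h : SwapClosed A) (s : ℕ) :
    SwapClosed (peelRest s A) := by
  intro e he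
  obtain ⟨h1, h2, h3⟩ := Finset.mem_filter.1 he
  exact Finset.mem_filter.2 ⟨h e h1, h3, h2⟩

/-- Every round of the static orientation on a subgraph of `A` removes at least a fraction of `1/q`
of the edges. -/
def Shrinks (s q : ℕ) (A : Finset (ℕ × ℕ)) : Prop :=
  ∀ A' ⊆ A, SwapClosed A' → A'.card + q * (peelRest s A').card ≤ q * A'.card

theorem Shrinks.mono {s q : ℕ} {A B : Finset (ℕ × ℕ)} (h : Shrinks s q B) (hAB : A ⊆ B) :
    Shrinks s q A := fun A' hA' hs => h A' (hA'.trans hAB) hs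

/-- If every round removes an edge, then `|A| / 2` rounds direct all edges. -/
theorem mem_peel_or_swap_mem_peel {s q k : ℕ} {A : Finset (ℕ × ℕ)} (hA : SwapClosed A)
    (hloop : ∀ e ∈ A, e.1 ≠ e.2) (hs : Shrinks s q A) (hk : A.card ≤ 2 * k) :
    ∀ e ∈ A, e ∈ peel s k A ∨ e.swap ∈ peel s k A := by
  induction k generalizing A with
  | zero =>
    have : A = ∅ := Finset.card_eq_zero.1 (by omega)
    simp [this]
  | succ k ih =>
    intro e he
    rw [peel_succ, Finset.mem_union, Finset.mem_union]
    by_cases hr : e ∈ peelRest s A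
    · have hcard : (peelRest s A).card + 2 ≤ A.card := by
        have h1 := hs A subset_rfl hA
        have hlt : (peelRest s A).card < A.card := by
          by_contra hcon
          have := Nat.mul_le_mul_left q (not_lt.1 hcon)
          have := Finset.card_pos.2 ⟨e, he⟩
          omega
        obtain ⟨f, hf, hfr⟩ := Finset.exists_mem_notMem_of_card_lt_card hlt
        have hsub : ({f, f.swap} : Finset (ℕ × ℕ)) ⊆ A \ peelRest s A := by
          intro g hg
          simp only [Finset.mem_insert, Finset.mem_singleton] at hg
          rw [Finset.mem_sdiff]
          rcases hg with rfl | rfl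
          · exact ⟨hf, hfr⟩
          · refine ⟨hA f hf, fun h => hfr ?_⟩
            simpa using hA.peelRest s _ h
        have hne : f ≠ f.swap := fun h => hloop f hf (congrArg Prod.fst h)
        have := Finset.card_le_card hsub
        rw [Finset.card_pair hne, Finset.card_sdiff_of_subset (peelRest_subset s A)] at this
        omega
      rcases ih (hA.peelRest s) (fun e he => hloop e (peelRest_subset s A he))
        (hs.mono (peelRest_subset s A)) (by omega) e hr with h | h
      · exact Or.inl (Or.inr h)
      · exact Or.inr (Or.inr h)
    · have hlp := hloop e he
      simp only [peelRest, peelOut, Finset.mem_filter, he, hA e he, true_and, Prod.fst_swap,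
        Prod.snd_swap] at hr ⊢
      by_cases h1 : outdeg A e.1 ≤ s <;> by_cases h2 : outdeg A e.2 ≤ s
      · rcases lt_or_gt_of_ne hlp with h | h
        · exact Or.inl (Or.inl ⟨h1, Or.inr h⟩)
        · exact Or.inr (Or.inl ⟨h2, Or.inr h⟩)
      · exact Or.inl (Or.inl ⟨h1, Or.inl h2⟩)
      · exact Or.inr (Or.inl ⟨h2, Or.inl h1⟩)
      · exact absurd ⟨h1, h2⟩ hr

theorem swapClosed_union_swap (H : Finset (ℕ × ℕ)) : SwapClosed (H ∪ H.image Prod.swap) := by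
  intro e he
  simp only [Finset.mem_union, Finset.mem_image] at he ⊢
  rcases he with h | ⟨f, hf, rfl⟩
  · exact Or.inr ⟨e, h, rfl⟩
  · exact Or.inl (by simpa using hf)

theorem outdeg_staticOrientation_le (s : ℕ) (H : Finset (ℕ × ℕ)) (v : ℕ) :
    outdeg (staticOrientation s H) v ≤ s := outdeg_peel_le _ _ _ _

theorem swap_notMem_staticOrientation (s : ℕ) (H : Finset (ℕ × ℕ)) :
    ∀ e ∈ staticOrientation s H, e.swap ∉ staticOrientation s H := swap_notMem_peel _ _ _

theorem mem_or_swap_mem_of_mem_staticOrientation {s : ℕ} {H : Finset (ℕ × ℕ)} {e : ℕ × ℕ}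
    (he : e ∈ staticOrientation s H) : e ∈ H ∨ e.swap ∈ H := by
  have := peel_subset _ _ _ he
  simp only [Finset.mem_union, Finset.mem_image] at this
  rcases this with h | ⟨f, hf, rfl⟩
  · exact Or.inl h
  · exact Or.inr (by simpa using hf)

theorem mem_staticOrientation_or {s q : ℕ} {H : Finset (ℕ × ℕ)} (hloop : ∀ e ∈ H, e.1 ≠ e.2)
    (hs : Shrinks s q (H ∪ H.image Prod.swap)) {e : ℕ × ℕ} (he : e ∈ H) :
    e ∈ staticOrientation s H ∨ e.swap ∈ staticOrientation s H := by
  refine mem_peel_or_swap_mem_peel (swapClosed_union_swap H) ?_ hs ?_ e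
    (Finset.mem_union_left _ he)
  · intro f hf
    simp only [Finset.mem_union, Finset.mem_image] at hf
    rcases hf with h | ⟨g, hg, rfl⟩
    · exact hloop f h
    · exact (hloop g hg).symm
  · refine (Finset.card_union_le _ _).trans ?_
    have := Finset.card_image_le (s := H) (f := Prod.swap)
    omega

/-! ### Bounded arboricity -/

theorem card_inter_sym2_le {n c : ℕ} {E : Finset (Sym2 ℕ)} (hE : ∀ e ∈ E, ¬ e.IsDiag)
    (harb : arboricity n E ≤ c) {S : Finset ℕ} (hS : S ⊆ Finset.range n) :
    (E ∩ S.sym2).card ≤ c * S.card := by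
  by_cases h2 : 2 ≤ S.card
  · have h1 : ⌈((E ∩ S.sym2).card : ℚ) / ((S.card : ℚ) - 1)⌉₊ ≤ c := by
      refine le_trans ?_ harb
      exact Finset.le_sup (f := fun S : Finset ℕ =>
        ⌈((E ∩ S.sym2).card : ℚ) / ((S.card : ℚ) - 1)⌉₊)
        (Finset.mem_filter.2 ⟨Finset.mem_powerset.2 hS, h2⟩)
    have h3 : ((E ∩ S.sym2).card : ℚ) / ((S.card : ℚ) - 1) ≤ c := Nat.ceil_le.1 h1
    have h4 : (2 : ℚ) ≤ S.card := by exact_mod_cast h2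
    rw [div_le_iff₀ (by linarith)] at h3
    have h5 : ((E ∩ S.sym2).card : ℚ) ≤ (c : ℚ) * S.card := by
      have : (0 : ℚ) ≤ c := Nat.cast_nonneg c
      nlinarith
    exact_mod_cast h5
  · have : E ∩ S.sym2 = ∅ := by
      rw [Finset.eq_empty_iff_forall_notMem]
      intro e he
      rw [Finset.mem_inter] at he
      induction e using Sym2.ind with
      | _ x y =>
        rw [Finset.mk_mem_sym2_iff] at he
        exact hE _ he.1 (Finset.card_le_one.1 (by omega) x he.2.1 y he.2.2)
    simp [this]

theorem card_fiber_undirect_le (A : Finset (ℕ × ℕ)) (b : Sym2 ℕ) :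
    (A.filter fun e => undirect e = b).card ≤ 2 := by
  induction b using Sym2.ind with
  | _ x y =>
    refine (Finset.card_le_card (t := {(x, y), (y, x)}) fun e he => ?_).trans Finset.card_le_two
    have := (Finset.mem_filter.1 he).2
    rw [show s(x, y) = undirect (x, y) from rfl, undirect_eq_iff] at this
    simpa using this

/-- The vertices that a round leaves unmarked have degree more than `s ≥ ⌊(2 + ε) c⌋`, while the
subgraph that they induce has at most `c` times as many edges as vertices. -/
theorem shrinks_of_arboricity_le {ε : ℝ} (hε : 0 < ε) {n c q : ℕ} {E : Finset (Sym2 ℕ)}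
    (hE : ∀ e ∈ E, ¬ e.IsDiag) (hn : ∀ e ∈ E, ∀ v ∈ e, v < n) (harb : arboricity n E ≤ c)
    (hq : 2 + ε ≤ q * ε) {A : Finset (ℕ × ℕ)} (hA : ∀ e ∈ A, undirect e ∈ E) :
    Shrinks ⌊(2 + ε) * c⌋₊ q A := by
  intro A' hA' _
  set s := ⌊(2 + ε) * c⌋₊ with hs
  set U := (Finset.range n).filter fun v => s < outdeg A' v with hU
  have h1 : (peelRest s A').card ≤ 2 * (E ∩ U.sym2).card := by
    refine Finset.card_le_mul_card_image_of_maps_to (f := undirect) ?_ 2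
      fun b _ => card_fiber_undirect_le _ b
    intro e he
    obtain ⟨heA, he1, he2⟩ := Finset.mem_filter.1 he
    have heE := hA e (hA' heA)
    rw [Finset.mem_inter]
    refine ⟨heE, ?_⟩
    rw [undirect, Finset.mk_mem_sym2_iff]
    simp only [hU, Finset.mem_filter, Finset.mem_range]
    exact ⟨⟨hn _ heE _ (Sym2.mem_mk_left _ _), not_le.1 he1⟩,
      hn _ heE _ (Sym2.mem_mk_right _ _), not_le.1 he2⟩
  have h2 : (E ∩ U.sym2).card ≤ c * U.card := card_inter_sym2_le hE harb (Finset.filter_subset _ _)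
  have h3 : U.card * (s + 1) ≤ A'.card := by
    calc U.card * (s + 1) = ∑ v ∈ U, (s + 1) := by simp
      _ ≤ ∑ v ∈ U, outdeg A' v := Finset.sum_le_sum fun v hv => (Finset.mem_filter.1 hv).2
      _ = ∑ v ∈ U, (A'.filter fun e => e.1 = v).card := rfl
      _ ≤ A'.card := by
          rw [Finset.sum_card_fiberwise_eq_card_filter]
          exact Finset.card_filter_le _ _
  have h4 : (2 + ε) * c ≤ (s : ℝ) + 1 := (Nat.lt_floor_add_one _).le
  have hA0 : (0 : ℝ) ≤ A'.card := Nat.cast_nonneg _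
  have key : (2 + ε) * ((peelRest s A').card : ℝ) ≤ 2 * A'.card := by
    rcases Nat.eq_zero_or_pos c with rfl | hc
    · have : (peelRest s A').card = 0 := by omega
      rw [this]; push_cast; linarith
    · have hc' : (0 : ℝ) < c := by exact_mod_cast hc
      have h1' : ((peelRest s A').card : ℝ) ≤ 2 * (c * U.card) := by
        exact_mod_cast h1.trans (Nat.mul_le_mul_left 2 h2)
      have h3' : (U.card : ℝ) * (s + 1) ≤ A'.card := by exact_mod_cast h3
      have h5 : (U.card : ℝ) * ((2 + ε) * c) ≤ A'.card :=
        (mul_le_mul_of_nonneg_left h4 (Nat.cast_nonneg _)).trans h3'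
      calc (2 + ε) * ((peelRest s A').card : ℝ) ≤ (2 + ε) * (2 * (c * U.card)) := by gcongr
        _ = 2 * (U.card * ((2 + ε) * c)) := by ring
        _ ≤ 2 * A'.card := by linarith
  have hfin : (2 + ε) * ((A'.card : ℝ) + q * (peelRest s A').card) ≤
      (2 + ε) * (q * A'.card) := by
    have h6 := mul_le_mul_of_nonneg_left key (Nat.cast_nonneg q)
    have h7 := mul_le_mul_of_nonneg_right hq hA0
    linarith
  have := le_of_mul_le_mul_left hfin (by linarith)
  exact_mod_cast this

/-! ### The static orientation program -/

namespace Prog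

/-- Marking the vertices of degree at most `s`. -/
theorem spec_markLoop (s : ℕ) (G : List (ℕ × List ℕ)) (m : Mem) :
    (forEach (fun g : ℕ × List ℕ => do
      steps g.2.length
      if g.2.length ≤ s then put (.mark g.1) 1) G).Spec m
    (fun _ m' => ∀ l, m'.word l =
      if ∃ g ∈ G, g.2.length ≤ s ∧ l = .mark g.1 then 1 else m.word l)
    (G.map fun g => g.2.length + 1 + 1).sum := by
  refine Spec.forEach (m := m) (fun pre m' => ∀ l, m'.word l =
      if ∃ g ∈ pre, g.2.length ≤ s ∧ l = .mark g.1 then 1 else m.word l)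
      (fun g => g.2.length + 1) G ?_ (by simp)
  intro pre g post m' _ hI
  refine Spec.bind (Spec.steps (fun _ m'' => m'' = m') rfl _) ?_
  rintro _ _ rfl
  split_ifs with hg
  · refine Spec.put fun l => ?_
    simp only [Function.update_apply, hI]
    by_cases hl : l = .mark g.1
    · subst hl
      rw [if_pos rfl, if_pos ⟨g, by simp, hg, rfl⟩]
    · rw [if_neg hl]
      congr 1
      simp only [List.mem_append, List.mem_singleton, eq_iff_iff]
      constructor
      · rintro ⟨x, hx, h⟩; exact ⟨x, Or.inl hx, h⟩
      · rintro ⟨x, hx | rfl, h⟩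
        · exact ⟨x, hx, h⟩
        · exact absurd h.2 hl
  · refine (Spec.pure fun l => ?_).mono_cost (Nat.zero_le _)
    rw [hI]
    congr 1
    simp only [List.mem_append, List.mem_singleton, eq_iff_iff]
    constructor
    · rintro ⟨x, hx, h⟩; exact ⟨x, Or.inl hx, h⟩
    · rintro ⟨x, hx | rfl, h⟩
      · exact ⟨x, hx, h⟩
      · exact absurd h.1 hg

theorem spec_unmarkLoop (G : List (ℕ × List ℕ)) (m : Mem) :
    (forEach (fun g : ℕ × List ℕ => put (.mark g.1) 0) G).Spec m
    (fun _ m' => ∀ l, m'.word l = if ∃ g ∈ G, l = .mark g.1 then 0 else m.word l)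
    (2 * G.length) := by
  refine Spec.mono_cost (Spec.forEach (m := m) (fun pre m' => ∀ l, m'.word l =
      if ∃ g ∈ pre, l = .mark g.1 then 0 else m.word l) (fun _ => 1) G ?_ (by simp))
      (by simp [mul_comm])
  intro pre g post m' _ hI
  refine Spec.put fun l => ?_
  simp only [Function.update_apply, hI]
  by_cases hl : l = .mark g.1
  · subst hl
    rw [if_pos rfl, if_pos ⟨g, by simp, rfl⟩]
  · rw [if_neg hl]
    congr 1
    simp only [List.mem_append, List.mem_singleton, eq_iff_iff]
    constructor
    · rintro ⟨x, hx, h⟩; exact ⟨x, Or.inl hx, h⟩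
    · rintro ⟨x, hx | rfl, h⟩
      · exact ⟨x, hx, h⟩
      · exact absurd h hl

/-- The rounds of the static orientation leave the word memory as it was and cost a geometric sum:
each round is linear in the number of remaining edges, which `Shrinks` makes decay. -/
theorem spec_peelLoop {p s q : ℕ} (hp : p.Prime) (k : ℕ) (A F : List (ℕ × ℕ)) (m : Mem)
    (hnd : A.Nodup) (hlt : ∀ e ∈ A, e.1 < p) (hsw : SwapClosed A.toFinset)
    (hs : Shrinks s q A.toFinset) (hmark : ∀ v, m.word (.mark v) = 0) :
    (peelLoop p s k A F).Spec m (fun X m' => m'.word = m.word ∧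
      ∃ Y, X = Y ++ F ∧ Y.Nodup ∧ Y.toFinset = peel s k A.toFinset)
      (27 * (q * A.length) + 1) := by
  induction k generalizing A F m with
  | zero =>
    refine Spec.mono_cost (c := 1) ?_ (by omega)
    exact Spec.step_bind (Spec.pure ⟨rfl, [], rfl, List.nodup_nil, rfl⟩)
  | succ k ih =>
    rw [peelLoop]
    by_cases hA : A = []
    · subst hA
      refine (Spec.step_bind (c := 0) ?_).mono_cost (by omega)
      rw [if_pos rfl]
      exact Spec.pure ⟨rfl, [], rfl, List.nodup_nil, by simp [peel_empty]⟩
    have hpos : 1 ≤ A.length := List.length_pos_of_ne_nil hA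
    -- `N` lists the edges directed in this round and `R` the remaining ones; the program computes the
    -- same lists from the marks
    let N := A.filter fun e => decide (outdeg A.toFinset e.1 ≤ s ∧
      (¬ outdeg A.toFinset e.2 ≤ s ∨ e.1 < e.2))
    let R := A.filter fun e => decide (¬ outdeg A.toFinset e.1 ≤ s ∧ ¬ outdeg A.toFinset e.2 ≤ s)
    have hN : N.toFinset = peelOut s A.toFinset := by
      ext e; simp [N, peelOut]
    have hR : R.toFinset = peelRest s A.toFinset := by
      ext e; simp [R, peelRest]
    have hRnd : R.Nodup := hnd.filter _
    have hNnd : N.Nodup := hnd.filter _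
    have hNlen : N.length ≤ A.length := List.length_filter_le _ _
    have hshrink : A.length + q * R.length ≤ q * A.length := by
      have := hs A.toFinset subset_rfl hsw
      rwa [← hR, List.toFinset_card_of_nodup hnd, List.toFinset_card_of_nodup hRnd] at this
    have hrec := fun m' hm' => ih R (N ++ F) m' hRnd
      (fun e he => hlt e (List.mem_of_mem_filter he)) (hR ▸ hsw.peelRest s)
      (hR ▸ hs.mono (peelRest_subset s _)) hm'
    refine Spec.mono_cost (c := (12 * A.length + 2 + (3 * A.length + ((2 + 1) * A.length +
      ((2 + 1) * A.length + (2 * A.length + (N.length + (27 * (q * R.length) + 1))))))) + 1) ?_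
      (by nlinarith)
    refine Spec.step_bind ?_
    rw [if_neg hA]
    refine Spec.bind (spec_groupBy hp A hlt m) ?_
    rintro G m₁ ⟨hw₁, hG⟩
    have hGlen := hG.length_le
    refine Spec.bind ((spec_markLoop s G m₁).mono_cost ?_) ?_
    · have := hG.sum_length
      simp only [List.sum_map_add, List.map_const', List.sum_replicate, smul_eq_mul]
      omega
    rintro - m₂ hw₂
    have hmk : ∀ e ∈ A, m₂.word (.mark e.1) = if outdeg A.toFinset e.1 ≤ s then 1 else 0 := by
      intro e he
      rw [hw₂, hw₁, hmark]
      congr 1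
      simp only [eq_iff_iff]
      constructor
      · rintro ⟨g, hg, hgl, hge⟩
        rw [Loc.mark.injEq] at hge
        rwa [hge, ← hG.length_group hnd hg]
      · intro hle
        obtain ⟨g, hg, hge, -⟩ := (hG.mem_iff e.1 e.2).1 he
        exact ⟨g, hg, by rwa [hG.length_group hnd hg, hge], by rw [hge]⟩
    have hmk1 : ∀ e ∈ A, m₂.word (.mark e.1) = 1 ↔ outdeg A.toFinset e.1 ≤ s := by
      intro e he; rw [hmk e he]; split_ifs with h <;> simp [h]
    have hmk2 : ∀ e ∈ A, m₂.word (.mark e.2) = 1 ↔ outdeg A.toFinset e.2 ≤ s := fun e he =>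
      hmk1 e.swap (List.mem_toFinset.1 (hsw e (List.mem_toFinset.2 he)))
    refine Spec.bind (Spec.select (fun e => decide (m₂.word (.mark e.1) = 1 ∧
      (m₂.word (.mark e.2) ≠ 1 ∨ e.1 < e.2))) 2 A fun e _ =>
      Spec.get_bind (Spec.get_bind (Spec.pure ⟨rfl, rfl⟩))) ?_
    rintro N' m₂ ⟨hN', rfl⟩
    have hN'' : N' = N := by
      rw [hN']
      refine List.filter_congr fun e he => ?_
      rw [decide_eq_decide, ne_eq, hmk1 e he, hmk2 e he]
    rw [hN'']
    refine Spec.bind (Spec.select (fun e => decide (m₂.word (.mark e.1) ≠ 1 ∧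
      m₂.word (.mark e.2) ≠ 1)) 2 A fun e _ =>
      Spec.get_bind (Spec.get_bind (Spec.pure ⟨rfl, rfl⟩))) ?_
    rintro R' m₂ ⟨hR', rfl⟩
    have hR'' : R' = R := by
      rw [hR']
      refine List.filter_congr fun e he => ?_
      rw [decide_eq_decide, ne_eq, ne_eq, hmk1 e he, hmk2 e he]
    rw [hR'']
    refine Spec.bind ((spec_unmarkLoop G m₂).mono_cost (by omega)) ?_
    rintro - m₃ hw₃
    have hw : m₃.word = m.word := by
      funext l
      rw [hw₃, hw₂, hw₁]
      by_cases h1 : ∃ g ∈ G, l = .mark g.1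
      · rw [if_pos h1]
        obtain ⟨g, -, rfl⟩ := h1
        rw [hmark]
      · rw [if_neg h1, if_neg]
        rintro ⟨g, hg, -, hl⟩
        exact h1 ⟨g, hg, hl⟩
    refine Spec.bind (Spec.steps (fun _ m' => m' = m₃) rfl _) ?_
    rintro _ _ rfl
    refine (hrec _ (fun v => by rw [hw, hmark])).mono ?_ le_rfl
    rintro X m' ⟨hw', Y, hX, hY, hYs⟩
    refine ⟨hw'.trans hw, Y ++ N, by rw [hX, List.append_assoc], ?_, ?_⟩
    · refine hY.append hNnd ?_
      intro e heY heN
      have h1 : e ∈ peelRest s A.toFinset := by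
        have : e ∈ Y.toFinset := List.mem_toFinset.2 heY
        rw [hYs, hR] at this
        exact peel_subset _ _ _ this
      have h2 : e ∈ peelOut s A.toFinset := hN ▸ List.mem_toFinset.2 heN
      exact (Finset.mem_filter.1 h1).2.1 (Finset.mem_filter.1 h2).2.1
    · rw [List.toFinset_append, hYs, hN, hR, peel_succ, Finset.union_comm]

/-- The static orientation program computes `staticOrientation` in linear expected time and leaves
the word memory as it was. -/
theorem spec_staticOrient {p s q : ℕ} (hp : p.Prime) (hq : 1 ≤ q) (A : List (ℕ × ℕ)) (m : Mem)
    (hnd : A.Nodup) (hlt : ∀ e ∈ A, e.1 < p ∧ e.2 < p) (hasym : ∀ e ∈ A, e.swap ∉ A)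
    (hs : Shrinks s q (A.toFinset ∪ A.toFinset.image Prod.swap))
    (hmark : ∀ v, m.word (.mark v) = 0) :
    (staticOrient p s A).Spec m (fun Y m' => m'.word = m.word ∧ Y.Nodup ∧
      Y.toFinset = staticOrientation s A.toFinset) (57 * (q * A.length) + 1) := by
  have hset : (A.flatMap fun e => [e, e.swap]).toFinset =
      A.toFinset ∪ A.toFinset.image Prod.swap := by
    ext e
    simp only [List.mem_toFinset, List.mem_flatMap, List.mem_cons, List.not_mem_nil, or_false,
      Finset.mem_union, Finset.mem_image]
    constructor
    · rintro ⟨f, hf, rfl | rfl⟩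
      · exact Or.inl hf
      · exact Or.inr ⟨f, hf, rfl⟩
    · rintro (h | ⟨f, hf, rfl⟩)
      · exact ⟨e, h, Or.inl rfl⟩
      · exact ⟨f, hf, Or.inr rfl⟩
  have hlen : (A.flatMap fun e => [e, e.swap]).length = 2 * A.length := by
    simp [List.length_flatMap, mul_comm]
  have hnd2 : (A.flatMap fun e => [e, e.swap]).Nodup := by
    rw [List.nodup_flatMap]
    refine ⟨fun e he => ?_, ?_⟩
    · have : e ≠ e.swap := fun h => hasym e he (h ▸ he)
      simpa using this
    · refine List.Pairwise.imp_of_mem ?_ hnd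
      intro e f he hf hef x hxe hxf
      simp only [List.mem_cons, List.not_mem_nil, or_false] at hxe hxf
      rcases hxe with rfl | rfl <;> rcases hxf with h | h
      · exact hef h
      · exact hasym f hf (h ▸ he)
      · exact hasym e he (h ▸ hf)
      · exact hef (Prod.swap_injective h)
  refine Spec.mono_cost (c := 3 * A.length + (27 * (q * (2 * A.length)) + 1)) ?_ (by nlinarith)
  refine Spec.bind ((Spec.collect (fun e => [e, e.swap]) (fun _ => 0) A
    fun e _ => Spec.pure ⟨rfl, rfl⟩).mono_cost (by simp [mul_comm])) ?_
  rintro _ _ ⟨rfl, rfl⟩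
  rw [← hlen]
  refine (spec_peelLoop hp A.length _ [] _ hnd2 ?_ (hset ▸ swapClosed_union_swap _)
    (hset ▸ hs) hmark).mono ?_ le_rfl
  · intro e he
    obtain ⟨f, hf, he⟩ := List.mem_flatMap.1 he
    simp only [List.mem_cons, List.not_mem_nil, or_false] at he
    rcases he with rfl | rfl
    · exact (hlt _ hf).1
    · exact (hlt _ hf).2
  · rintro X m' ⟨hw, Y, rfl, hY, hYs⟩
    refine ⟨hw, by simpa using hY, ?_⟩
    rw [List.append_nil, hYs, hset, staticOrientation, List.toFinset_card_of_nodup hnd]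

end Prog

/-! ### Bags -/

/-- The bag to which a memory cell belongs, if any. -/
def Loc.bag : Loc → Option BagId
  | .size b => some b
  | .item b _ => some b
  | .pos b _ => some b
  | _ => none

/-- The bag `b` holds the set `S`: the slots `0, …, |S| - 1` list its elements, and the cells `pos`
invert this list. -/
structure HoldsBag (m : Mem) (b : BagId) (S : Finset ℕ) : Prop where
  size : m.word (.size b) = S.card
  pos_lt : ∀ x ∈ S, m.word (.pos b x) < S.card
  item_pos : ∀ x ∈ S, m.word (.item b (m.word (.pos b x))) = x
  item_mem : ∀ i < S.card, m.word (.item b i) ∈ S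
  pos_item : ∀ i < S.card, m.word (.pos b (m.word (.item b i))) = i

namespace HoldsBag

variable {m m' : Mem} {b : BagId} {S : Finset ℕ}

theorem congr (h : HoldsBag m b S) (hm : ∀ l, l.bag = some b → m'.word l = m.word l) :
    HoldsBag m' b S := by
  have hs : m'.word (.size b) = m.word (.size b) := hm _ rfl
  have hi : ∀ i, m'.word (.item b i) = m.word (.item b i) := fun i => hm _ rfl
  have hp : ∀ x, m'.word (.pos b x) = m.word (.pos b x) := fun x => hm _ rfl
  refine ⟨?_, ?_, ?_, ?_, ?_⟩
  · rw [hs]; exact h.size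
  · simp only [hp]; exact h.pos_lt
  · simp only [hp, hi]; exact h.item_pos
  · simp only [hi]; exact h.item_mem
  · simp only [hp, hi]; exact h.pos_item

end HoldsBag

/-- The contents of the bag `b` in the order of its slots. -/
def bagList (m : Mem) (b : BagId) : List ℕ :=
  (List.range (m.word (.size b))).map fun i => m.word (.item b i)

namespace HoldsBag

variable {m : Mem} {b : BagId} {S : Finset ℕ}

theorem nodup_bagList (h : HoldsBag m b S) : (bagList m b).Nodup := by
  refine List.Nodup.map_on ?_ List.nodup_range
  intro i hi j hj hij
  rw [List.mem_range, h.size] at hi hj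
  rw [← h.pos_item i hi, ← h.pos_item j hj, hij]

theorem mem_bagList (h : HoldsBag m b S) {x : ℕ} : x ∈ bagList m b ↔ x ∈ S := by
  rw [bagList, List.mem_map, h.size]
  constructor
  · rintro ⟨i, hi, rfl⟩; exact h.item_mem i (List.mem_range.1 hi)
  · intro hx; exact ⟨_, List.mem_range.2 (h.pos_lt x hx), h.item_pos x hx⟩

theorem length_bagList (h : HoldsBag m b S) : (bagList m b).length = S.card := by
  rw [bagList, List.length_map, List.length_range, h.size]

end HoldsBag

namespace Prog

theorem spec_bagInsert {m : Mem} {b : BagId} {S : Finset ℕ} {x : ℕ} (h : HoldsBag m b S)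
    (hx : x ∉ S) : (bagInsert b x).Spec m (fun _ m' => HoldsBag m' b (insert x S) ∧
      ∀ l, l.bag ≠ some b → m'.word l = m.word l) 4 := by
  refine Spec.get_bind (Spec.put_bind (Spec.put_bind (Spec.put ⟨?_, ?_⟩)))
  · have hne : ∀ y ∈ S, y ≠ x := fun y hy hyx => hx (hyx ▸ hy)
    have hcard := Finset.card_insert_of_notMem hx
    refine ⟨?_, ?_, ?_, ?_, ?_⟩
    · simp [h.size, hcard]
    · intro y hy
      rcases Finset.mem_insert.1 hy with rfl | hy
      · simp [h.size, hcard]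
      · have := h.pos_lt y hy
        simp [hne y hy, hcard]; omega
    · intro y hy
      rcases Finset.mem_insert.1 hy with rfl | hy
      · simp
      · have := h.pos_lt y hy
        simp [hne y hy, h.size, this.ne, h.item_pos y hy]
    · intro i hi
      rcases Nat.lt_succ_iff_lt_or_eq.1 (hcard ▸ hi) with hi | rfl
      · simp [h.size, hi.ne, h.item_mem i hi]
      · simp [h.size]
    · intro i hi
      rcases Nat.lt_succ_iff_lt_or_eq.1 (hcard ▸ hi) with hi | rfl
      · simp [h.size, hi.ne, hne _ (h.item_mem i hi), h.pos_item i hi]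
      · simp [h.size]
  · intro l hl
    have h1 : l ≠ .size b := fun h => hl (by rw [h]; rfl)
    have h2 : l ≠ .pos b x := fun h => hl (by rw [h]; rfl)
    have h3 : l ≠ .item b (m.word (.size b)) := fun h => hl (by rw [h]; rfl)
    simp [h1, h2, h3]

theorem spec_bagDelete {m : Mem} {b : BagId} {S : Finset ℕ} {x : ℕ} (h : HoldsBag m b S)
    (hx : x ∈ S) : (bagDelete b x).Spec m (fun _ m' => HoldsBag m' b (S.erase x) ∧
      ∀ l, l.bag ≠ some b → m'.word l = m.word l) 6 := by
  refine Spec.get_bind (Spec.get_bind (Spec.get_bind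
    (Spec.put_bind (Spec.put_bind (Spec.put ⟨?_, ?_⟩)))))
  · have hpos : 0 < S.card := Finset.card_pos.2 ⟨x, hx⟩
    have hcard : (S.erase x).card = S.card - 1 := Finset.card_erase_of_mem hx
    have hlast : S.card - 1 < S.card := by omega
    have hi₀ := h.pos_lt x hx
    -- the element of the last slot, which moves to the slot of `x`
    obtain ⟨y, hy⟩ : ∃ y, m.word (.item b (S.card - 1)) = y := ⟨_, rfl⟩
    have hyS : y ∈ S := hy ▸ h.item_mem _ hlast
    have hposy : m.word (.pos b y) = S.card - 1 := hy ▸ h.pos_item _ hlast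
    simp only [h.size, hy]
    refine ⟨?_, ?_, ?_, ?_, ?_⟩
    · simp [hcard]
    · intro z hz
      obtain ⟨hzx, hzS⟩ := Finset.mem_erase.1 hz
      rw [hcard]
      by_cases hzy : z = y
      · subst hzy
        have : m.word (.pos b x) ≠ S.card - 1 := by
          intro h'
          exact hzx (by rw [← h.item_pos x hx, h', hy])
        simp; omega
      · have h1 := h.pos_lt z hzS
        have : m.word (.pos b z) ≠ S.card - 1 := by
          intro h'
          exact hzy (by rw [← h.item_pos z hzS, h', hy])
        simp [hzy]; omega
    · intro z hz
      obtain ⟨hzx, hzS⟩ := Finset.mem_erase.1 hz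
      by_cases hzy : z = y
      · subst hzy; simp
      · have : m.word (.pos b z) ≠ m.word (.pos b x) := by
          intro h'
          exact hzx (by rw [← h.item_pos z hzS, h', h.item_pos x hx])
        simp [hzy, this, h.item_pos z hzS]
    · intro i hi
      rw [hcard] at hi
      rw [Finset.mem_erase]
      by_cases hix : i = m.word (.pos b x)
      · have : y ≠ x := by
          intro hyx; rw [hyx] at hposy; omega
        simp [hix, this, hyS]
      · have hne : m.word (.item b i) ≠ x := by
          intro h'
          exact hix (by rw [← h.pos_item i (by omega), h'])
        simp [hix, hne, h.item_mem i (by omega)]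
    · intro i hi
      rw [hcard] at hi
      by_cases hix : i = m.word (.pos b x)
      · simp [hix]
      · have hne : m.word (.item b i) ≠ y := by
          intro h'
          have := h.pos_item i (by omega)
          rw [h'] at this; omega
        simp [hix, hne, h.pos_item i (by omega)]
  · intro l hl
    have h1 : l ≠ .size b := fun h => hl (by rw [h]; rfl)
    have h2 : ∀ x, l ≠ .pos b x := fun x h => hl (by rw [h]; rfl)
    have h3 : ∀ i, l ≠ .item b i := fun i h => hl (by rw [h]; rfl)
    simp [h1, h2, h3]

theorem spec_bagPeek {m : Mem} {b : BagId} {S : Finset ℕ} (h : HoldsBag m b S) :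
    (bagPeek b).Spec m (fun L m' => L = bagList m b ∧ m' = m) (3 * S.card + 1) := by
  refine Spec.get_bind ?_
  refine Spec.mono (Spec.collect (fun i => [m.word (.item b i)]) (fun _ => 1) _
    fun i _ => Spec.get_bind (Spec.pure ⟨rfl, rfl⟩)) ?_ ?_
  · rintro L m' ⟨rfl, rfl⟩
    exact ⟨by rw [bagList, List.map_eq_flatMap], rfl⟩
  · simp [h.size, mul_comm]

end Prog

/-! ### The memory representation of an orientation -/

/-- The heads of the edges of `D` that leave `u`. -/
def heads (D : Finset (ℕ × ℕ)) (u : ℕ) : Finset ℕ := (D.filter fun e => e.1 = u).image Prod.snd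

theorem mem_heads {D : Finset (ℕ × ℕ)} {u v : ℕ} : v ∈ heads D u ↔ (u, v) ∈ D := by
  simp [heads]

theorem card_heads (D : Finset (ℕ × ℕ)) (u : ℕ) : (heads D u).card = outdeg D u := by
  rw [heads, outdeg, Finset.card_image_of_injOn]
  intro e he f hf hef
  simp only [Finset.coe_filter, Set.mem_ofPred_eq] at he hf
  exact Prod.ext (he.2.trans hf.2.symm) hef

/-- The memory `m` holds the orientation `D`, with the vertices of `H` in the bag `high` and the
other vertices below `n` in the bag `low`, and all marks are cleared. -/
structure Holds (n : ℕ) (m : Mem) (D : Finset (ℕ × ℕ)) (H : Finset ℕ) : Prop where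
  out : ∀ u, HoldsBag m (.out u) (heads D u)
  dir : ∀ u v, m.word (.dir u v) = if (u, v) ∈ D then 1 else 0
  high : HoldsBag m .high H
  low : HoldsBag m .low (Finset.range n \ H)
  isHigh : ∀ v, m.word (.isHigh v) = if v ∈ H then 1 else 0
  mark : ∀ v, m.word (.mark v) = 0

/-- The vertices below `n` of out-degree greater than `T`. -/
def highSet (T n : ℕ) (D : Finset (ℕ × ℕ)) : Finset ℕ :=
  (Finset.range n).filter fun v => T < outdeg D v

theorem Holds.congr {n : ℕ} {m m' : Mem} {D : Finset (ℕ × ℕ)} {H : Finset ℕ} (h : Holds n m D H)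
    (hm : m'.word = m.word) : Holds n m' D H := by
  refine ⟨fun u => (h.out u).congr fun l _ => by rw [hm], ?_,
    h.high.congr fun l _ => by rw [hm], h.low.congr fun l _ => by rw [hm], ?_, ?_⟩
  · rw [hm]; exact h.dir
  · rw [hm]; exact h.isHigh
  · rw [hm]; exact h.mark

theorem Holds.stores {n : ℕ} {m : Mem} {D : Finset (ℕ × ℕ)} {H : Finset ℕ} (h : Holds n m D H) :
    m.Stores D := by
  intro u v
  refine ⟨?_, ?_, ?_⟩
  · rw [h.dir]; split_ifs with h' <;> simp [h']
  · rw [← mem_heads, ← (h.out u).mem_bagList, bagList, List.mem_map]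
    simp
  · rw [(h.out u).size, card_heads]

theorem holds_init (T n : ℕ) : Holds n (Mem.init n) ∅ (highSet T n ∅) := by
  have : highSet T n ∅ = ∅ := by simp [highSet, outdeg]
  rw [this]
  refine ⟨fun u => ?_, ?_, ?_, ?_, ?_, ?_⟩
  · constructor <;> simp [heads, Mem.init]
  · simp [Mem.init]
  · constructor <;> simp [Mem.init]
  · constructor <;> simp [Mem.init]
  · simp [Mem.init]
  · simp [Mem.init]

namespace Prog

theorem spec_addEdge {n : ℕ} {m : Mem} {D : Finset (ℕ × ℕ)} {H : Finset ℕ} {u v : ℕ}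
    (h : Holds n m D H) (huv : (u, v) ∉ D) :
    (do bagInsert (.out u) v; put (.dir u v) 1 : Prog Unit).Spec m
      (fun _ m' => Holds n m' (insert (u, v) D) H) 5 := by
  refine Spec.bind (c := 4) (d := 1)
    (spec_bagInsert (h.out u) (fun hv => huv (mem_heads.1 hv))) ?_
  rintro - m' ⟨hb, hw⟩
  refine Spec.put ⟨?_, ?_, ?_, ?_, ?_, ?_⟩
  · intro w
    by_cases hwu : w = u
    · subst hwu
      have : heads (insert (w, v) D) w = insert v (heads D w) := by
        ext x; simp [mem_heads]
      rw [this]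
      refine hb.congr fun l hl => ?_
      exact Function.update_of_ne (by rintro rfl; simp [Loc.bag] at hl) _ _
    · have : heads (insert (u, v) D) w = heads D w := by
        ext x; simp [mem_heads, hwu]
      rw [this]
      refine (h.out w).congr fun l hl => ?_
      refine (Function.update_of_ne (by rintro rfl; simp [Loc.bag] at hl) _ _).trans (hw l ?_)
      rw [hl]; simpa using hwu
  · intro w x
    simp only [Function.update_apply, Loc.dir.injEq]
    rw [hw _ (by simp [Loc.bag]), h.dir]
    simp only [Finset.mem_insert, Prod.mk.injEq]
    split_ifs <;> tauto
  · refine h.high.congr fun l hl => ?_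
    refine (Function.update_of_ne (by rintro rfl; simp [Loc.bag] at hl) _ _).trans (hw l ?_)
    rw [hl]; simp
  · refine h.low.congr fun l hl => ?_
    refine (Function.update_of_ne (by rintro rfl; simp [Loc.bag] at hl) _ _).trans (hw l ?_)
    rw [hl]; simp
  · intro w
    dsimp only
    rw [Function.update_of_ne (by simp), hw _ (by simp [Loc.bag]), h.isHigh]
  · intro w
    dsimp only
    rw [Function.update_of_ne (by simp), hw _ (by simp [Loc.bag]), h.mark]

theorem spec_removeEdge {n : ℕ} {m : Mem} {D : Finset (ℕ × ℕ)} {H : Finset ℕ} {u v : ℕ}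
    (h : Holds n m D H) (huv : (u, v) ∈ D) :
    (do bagDelete (.out u) v; put (.dir u v) 0 : Prog Unit).Spec m
      (fun _ m' => Holds n m' (D.erase (u, v)) H) 7 := by
  refine Spec.bind (c := 6) (d := 1) (spec_bagDelete (h.out u) (mem_heads.2 huv)) ?_
  rintro - m' ⟨hb, hw⟩
  refine Spec.put ⟨?_, ?_, ?_, ?_, ?_, ?_⟩
  · intro w
    by_cases hwu : w = u
    · subst hwu
      have : heads (D.erase (w, v)) w = (heads D w).erase v := by
        ext x; simp [mem_heads]
      rw [this]
      refine hb.congr fun l hl => ?_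
      exact Function.update_of_ne (by rintro rfl; simp [Loc.bag] at hl) _ _
    · have : heads (D.erase (u, v)) w = heads D w := by
        ext x; simp [mem_heads, hwu]
      rw [this]
      refine (h.out w).congr fun l hl => ?_
      refine (Function.update_of_ne (by rintro rfl; simp [Loc.bag] at hl) _ _).trans (hw l ?_)
      rw [hl]; simpa using hwu
  · intro w x
    simp only [Function.update_apply, Loc.dir.injEq]
    rw [hw _ (by simp [Loc.bag]), h.dir]
    simp only [Finset.mem_erase, ne_eq, Prod.mk.injEq]
    split_ifs <;> tauto
  · refine h.high.congr fun l hl => ?_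
    refine (Function.update_of_ne (by rintro rfl; simp [Loc.bag] at hl) _ _).trans (hw l ?_)
    rw [hl]; simp
  · refine h.low.congr fun l hl => ?_
    refine (Function.update_of_ne (by rintro rfl; simp [Loc.bag] at hl) _ _).trans (hw l ?_)
    rw [hl]; simp
  · intro w
    dsimp only
    rw [Function.update_of_ne (by simp), hw _ (by simp [Loc.bag]), h.isHigh]
  · intro w
    dsimp only
    rw [Function.update_of_ne (by simp), hw _ (by simp [Loc.bag]), h.mark]

/-- `refresh` corrects the class of `u` alone, so the other vertices may be in the wrong bag before
and after. -/
theorem spec_refresh {n T u : ℕ} {m : Mem} {D : Finset (ℕ × ℕ)} {H : Finset ℕ} (hu : u < n)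
    (h : Holds n m D H) :
    (refresh T u).Spec m
      (fun _ m' => Holds n m' D (if T < outdeg D u then insert u H else H.erase u)) 13 := by
  refine Spec.get_bind (Spec.get_bind ?_)
  rw [(h.out u).size, card_heads, h.isHigh]
  by_cases hT : T < outdeg D u <;> by_cases hH : u ∈ H
  · simp only [hT, hH, if_true, Nat.one_ne_zero, and_false, not_le.2 hT, false_and, if_false]
    refine (Spec.pure ?_).mono_cost (Nat.zero_le _)
    rwa [Finset.insert_eq_self.2 hH]
  · simp only [hT, hH, if_true, if_false, and_self]
    refine Spec.bind (c := 6) (d := 5) (spec_bagDelete h.low (x := u) (by simp [hu, hH])) ?_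
    rintro - m₁ ⟨hb₁, hw₁⟩
    have hhigh₁ : HoldsBag m₁ .high H := h.high.congr fun l hl => hw₁ l (by rw [hl]; simp)
    refine Spec.bind (c := 4) (d := 1) (spec_bagInsert hhigh₁ hH) ?_
    rintro - m₂ ⟨hb₂, hw₂⟩
    refine Spec.put ⟨?_, ?_, ?_, ?_, ?_, ?_⟩
    · intro w
      refine (h.out w).congr fun l hl => ?_
      refine (Function.update_of_ne (by rintro rfl; simp [Loc.bag] at hl) _ _).trans ?_
      rw [hw₂ l (by rw [hl]; simp), hw₁ l (by rw [hl]; simp)]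
    · intro w x
      dsimp only
      rw [Function.update_of_ne (by simp), hw₂ _ (by simp [Loc.bag]), hw₁ _ (by simp [Loc.bag]),
        h.dir]
    · refine hb₂.congr fun l hl => ?_
      exact Function.update_of_ne (by rintro rfl; simp [Loc.bag] at hl) _ _
    · have : Finset.range n \ insert u H = (Finset.range n \ H).erase u := by
        ext x; simp; tauto
      rw [this]
      refine hb₁.congr fun l hl => ?_
      refine (Function.update_of_ne (by rintro rfl; simp [Loc.bag] at hl) _ _).trans ?_
      exact hw₂ l (by rw [hl]; simp)
    · intro w
      simp only [Function.update_apply, Loc.isHigh.injEq]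
      rw [hw₂ _ (by simp [Loc.bag]), hw₁ _ (by simp [Loc.bag]), h.isHigh]
      simp only [Finset.mem_insert]
      split_ifs <;> tauto
    · intro w
      dsimp only
      rw [Function.update_of_ne (by simp), hw₂ _ (by simp [Loc.bag]), hw₁ _ (by simp [Loc.bag]),
        h.mark]
  · simp only [hT, hH, if_true, if_false, not_lt.1 hT, ne_eq, Nat.one_ne_zero,
      not_false_eq_true, and_self]
    refine Spec.bind (c := 6) (d := 5) (spec_bagDelete h.high hH) ?_
    rintro - m₁ ⟨hb₁, hw₁⟩
    have hlow₁ : HoldsBag m₁ .low (Finset.range n \ H) :=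
      h.low.congr fun l hl => hw₁ l (by rw [hl]; simp)
    refine Spec.bind (c := 4) (d := 1) (spec_bagInsert hlow₁ (x := u) (by simp [hH])) ?_
    rintro - m₂ ⟨hb₂, hw₂⟩
    refine Spec.put ⟨?_, ?_, ?_, ?_, ?_, ?_⟩
    · intro w
      refine (h.out w).congr fun l hl => ?_
      refine (Function.update_of_ne (by rintro rfl; simp [Loc.bag] at hl) _ _).trans ?_
      rw [hw₂ l (by rw [hl]; simp), hw₁ l (by rw [hl]; simp)]
    · intro w x
      dsimp only
      rw [Function.update_of_ne (by simp), hw₂ _ (by simp [Loc.bag]), hw₁ _ (by simp [Loc.bag]),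
        h.dir]
    · refine hb₁.congr fun l hl => ?_
      refine (Function.update_of_ne (by rintro rfl; simp [Loc.bag] at hl) _ _).trans ?_
      exact hw₂ l (by rw [hl]; simp)
    · have : Finset.range n \ H.erase u = insert u (Finset.range n \ H) := by
        ext x
        simp only [Finset.mem_sdiff, Finset.mem_range, Finset.mem_erase, Finset.mem_insert]
        by_cases hx : x = u
        · simp [hx, hu]
        · simp [hx]
      rw [this]
      refine hb₂.congr fun l hl => ?_
      exact Function.update_of_ne (by rintro rfl; simp [Loc.bag] at hl) _ _
    · intro w
      simp only [Function.update_apply, Loc.isHigh.injEq]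
      rw [hw₂ _ (by simp [Loc.bag]), hw₁ _ (by simp [Loc.bag]), h.isHigh]
      simp only [Finset.mem_erase]
      split_ifs <;> tauto
    · intro w
      dsimp only
      rw [Function.update_of_ne (by simp), hw₂ _ (by simp [Loc.bag]), hw₁ _ (by simp [Loc.bag]),
        h.mark]
  · simp only [hT, hH, if_false, false_and, ne_eq, not_true_eq_false, and_false]
    refine (Spec.pure ?_).mono_cost (Nat.zero_le _)
    rwa [Finset.erase_eq_of_notMem hH]

end Prog

/-- Changing the out-edges of one vertex `u` changes `highSet` as `refresh` does. -/
theorem highSet_eq_of_outdeg_eq {T n u : ℕ} {D D' : Finset (ℕ × ℕ)} (hu : u < n)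
    (h : ∀ v, v ≠ u → outdeg D' v = outdeg D v) :
    highSet T n D' =
      if T < outdeg D' u then insert u (highSet T n D) else (highSet T n D).erase u := by
  ext v
  by_cases hv : v = u
  · subst hv
    split_ifs with hT <;> simp [highSet, hT, hu]
  · split_ifs with hT <;> simp [highSet, hv, h v hv]

theorem outdeg_congr {D D' : Finset (ℕ × ℕ)} {v : ℕ} (h : ∀ w, (v, w) ∈ D' ↔ (v, w) ∈ D) :
    outdeg D' v = outdeg D v := by
  rw [outdeg, outdeg]
  congr 1
  ext ⟨a, b⟩
  simp only [Finset.mem_filter]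
  constructor
  · rintro ⟨h1, rfl⟩; exact ⟨(h b).1 h1, rfl⟩
  · rintro ⟨h1, rfl⟩; exact ⟨(h b).2 h1, rfl⟩

theorem ungroup_append (G G' : List (ℕ × List ℕ)) :
    ungroup (G ++ G') = ungroup G ++ ungroup G' := by
  simp [ungroup]

theorem ungroup_singleton (g : ℕ × List ℕ) : ungroup [g] = g.2.map (Prod.mk g.1) := by
  simp [ungroup]

namespace Prog

/-- Adding edges, grouped by their tails, to the stored orientation. -/
theorem spec_addEdges {n p T : ℕ} (hp : p.Prime) (hnp : n ≤ p) {m : Mem} {D : Finset (ℕ × ℕ)}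
    (h : Holds n m D (highSet T n D)) (A : List (ℕ × ℕ)) (hA : A.Nodup) (hlt : ∀ e ∈ A, e.1 < n)
    (hD : ∀ e ∈ A, e ∉ D) :
    (addEdges p T A).Spec m (fun _ m' => Holds n m' (D ∪ A.toFinset)
      (highSet T n (D ∪ A.toFinset))) (32 * A.length + 2) := by
  refine Spec.mono_cost (c := (12 * A.length + 2) + 20 * A.length) ?_ (by omega)
  refine Spec.bind (spec_groupBy hp A (fun e he => (hlt e he).trans_le hnp) m) ?_
  rintro G m₁ ⟨hw₁, hG⟩
  have hnd : (ungroup G).Nodup := hG.perm.nodup_iff.2 hA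
  refine Spec.mono (Spec.forEach (fun pre m' => Holds n m' (D ∪ (ungroup pre).toFinset)
    (highSet T n (D ∪ (ungroup pre).toFinset))) (fun g => 6 * g.2.length + 13) G ?_ ?_) ?_ ?_
  · intro pre g post m' hpre hI
    have hgG : g ∈ G := by rw [hpre]; simp
    have hgn : g.1 < n := by
      obtain ⟨e, he, heg⟩ := hG.exists_mem_of_key hgG
      exact heg ▸ hlt e he
    have hunion : ∀ L : List ℕ, ∀ v, (D ∪ (ungroup pre).toFinset) ∪
        ((L ++ [v]).map (Prod.mk g.1)).toFinset =
        insert (g.1, v) ((D ∪ (ungroup pre).toFinset) ∪ (L.map (Prod.mk g.1)).toFinset) := by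
      intro L v; ext e; simp
    refine Spec.bind (Q := fun _ m'' => Holds n m''
      ((D ∪ (ungroup pre).toFinset) ∪ (g.2.map (Prod.mk g.1)).toFinset)
      (highSet T n (D ∪ (ungroup pre).toFinset))) ?_ ?_
    · refine Spec.mono_cost (Spec.forEach (fun L m'' => Holds n m''
        ((D ∪ (ungroup pre).toFinset) ∪ (L.map (Prod.mk g.1)).toFinset)
        (highSet T n (D ∪ (ungroup pre).toFinset))) (fun _ => 5) g.2 ?_ (by simpa using hI))
        (by simp [mul_comm])
      intro L v L' m'' hL hI'
      rw [hunion]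
      refine spec_addEdge hI' ?_
      rw [hpre, ungroup_append, ← List.singleton_append, ungroup_append, ungroup_singleton, hL,
        List.map_append, List.map_cons] at hnd
      have h2 := (List.nodup_append.1 hnd).2.2
      have h1 := (List.nodup_append.1 (List.nodup_append.1 (List.nodup_append.1 hnd).2.1).1).2.2
      have hvA : (g.1, v) ∈ A := (hG.mem_group_iff hgG v).1 (by rw [hL]; simp)
      simp only [Finset.mem_union, List.mem_toFinset, not_or]
      refine ⟨⟨hD _ hvA, fun h' => h2 _ h' (g.1, v) (by simp) rfl⟩, fun h' => ?_⟩
      exact h1 _ h' (g.1, v) (by simp) rfl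
    · rintro - m'' hI'
      have heq : D ∪ (ungroup (pre ++ [g])).toFinset =
          (D ∪ (ungroup pre).toFinset) ∪ (g.2.map (Prod.mk g.1)).toFinset := by
        rw [ungroup_append, ungroup_singleton, List.toFinset_append, Finset.union_assoc]
      rw [heq]
      rw [highSet_eq_of_outdeg_eq (D := D ∪ (ungroup pre).toFinset) hgn]
      · exact spec_refresh hgn hI'
      · intro v hv
        refine outdeg_congr fun w => ?_
        simp [Ne.symm hv]
  · simpa [ungroup] using h.congr hw₁
  · rintro - m' hI
    have : (ungroup G).toFinset = A.toFinset := by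
      ext e; simp only [List.mem_toFinset]; exact hG.perm.mem_iff
    rwa [this] at hI
  · have h1 := hG.sum_length
    have h2 := hG.length_le
    simp only [List.sum_map_add, List.map_const', List.sum_replicate, smul_eq_mul,
      List.sum_map_mul_left]
    omega

/-- Removing edges, grouped by their tails, from the stored orientation. -/
theorem spec_removeEdges {n p T : ℕ} (hp : p.Prime) (hnp : n ≤ p) {m : Mem} {D : Finset (ℕ × ℕ)}
    (h : Holds n m D (highSet T n D)) (A : List (ℕ × ℕ)) (hA : A.Nodup) (hlt : ∀ e ∈ A, e.1 < n)
    (hD : ∀ e ∈ A, e ∈ D) :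
    (removeEdges p T A).Spec m (fun _ m' => Holds n m' (D \ A.toFinset)
      (highSet T n (D \ A.toFinset))) (34 * A.length + 2) := by
  refine Spec.mono_cost (c := (12 * A.length + 2) + 22 * A.length) ?_ (by omega)
  refine Spec.bind (spec_groupBy hp A (fun e he => (hlt e he).trans_le hnp) m) ?_
  rintro G m₁ ⟨hw₁, hG⟩
  have hnd : (ungroup G).Nodup := hG.perm.nodup_iff.2 hA
  refine Spec.mono (Spec.forEach (fun pre m' => Holds n m' (D \ (ungroup pre).toFinset)
    (highSet T n (D \ (ungroup pre).toFinset))) (fun g => 8 * g.2.length + 13) G ?_ ?_) ?_ ?_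
  · intro pre g post m' hpre hI
    have hgG : g ∈ G := by rw [hpre]; simp
    have hgn : g.1 < n := by
      obtain ⟨e, he, heg⟩ := hG.exists_mem_of_key hgG
      exact heg ▸ hlt e he
    have hsdiff : ∀ L : List ℕ, ∀ v, (D \ (ungroup pre).toFinset) \
        ((L ++ [v]).map (Prod.mk g.1)).toFinset =
        ((D \ (ungroup pre).toFinset) \ (L.map (Prod.mk g.1)).toFinset).erase (g.1, v) := by
      intro L v
      ext e
      simp only [List.map_append, List.map_cons, List.map_nil, List.toFinset_append,
        Finset.mem_sdiff, Finset.mem_union, List.mem_toFinset, List.mem_singleton,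
        Finset.mem_erase]
      tauto
    refine Spec.bind (Q := fun _ m'' => Holds n m''
      ((D \ (ungroup pre).toFinset) \ (g.2.map (Prod.mk g.1)).toFinset)
      (highSet T n (D \ (ungroup pre).toFinset))) ?_ ?_
    · refine Spec.mono_cost (Spec.forEach (fun L m'' => Holds n m''
        ((D \ (ungroup pre).toFinset) \ (L.map (Prod.mk g.1)).toFinset)
        (highSet T n (D \ (ungroup pre).toFinset))) (fun _ => 7) g.2 ?_ (by simpa using hI))
        (by simp [mul_comm])
      intro L v L' m'' hL hI'
      rw [hsdiff]
      refine spec_removeEdge hI' ?_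
      rw [hpre, ungroup_append, ← List.singleton_append, ungroup_append, ungroup_singleton, hL,
        List.map_append, List.map_cons] at hnd
      have h2 := (List.nodup_append.1 hnd).2.2
      have h1 := (List.nodup_append.1 (List.nodup_append.1 (List.nodup_append.1 hnd).2.1).1).2.2
      have hvA : (g.1, v) ∈ A := (hG.mem_group_iff hgG v).1 (by rw [hL]; simp)
      simp only [Finset.mem_sdiff, List.mem_toFinset]
      refine ⟨⟨hD _ hvA, fun h' => h2 _ h' (g.1, v) (by simp) rfl⟩, fun h' => ?_⟩
      exact h1 _ h' (g.1, v) (by simp) rfl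
    · rintro - m'' hI'
      have heq : D \ (ungroup (pre ++ [g])).toFinset =
          (D \ (ungroup pre).toFinset) \ (g.2.map (Prod.mk g.1)).toFinset := by
        rw [ungroup_append, ungroup_singleton, List.toFinset_append, Finset.sdiff_union_distrib]
        ext e; simp only [Finset.mem_sdiff, Finset.mem_inter]; tauto
      rw [heq]
      rw [highSet_eq_of_outdeg_eq (D := D \ (ungroup pre).toFinset) hgn]
      · exact spec_refresh hgn hI'
      · intro v hv
        refine outdeg_congr fun w => ?_
        simp [Ne.symm hv]
  · simpa [ungroup] using h.congr hw₁
  · rintro - m' hI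
    have : (ungroup G).toFinset = A.toFinset := by
      ext e; simp only [List.mem_toFinset]; exact hG.perm.mem_iff
    rwa [this] at hI
  · have h1 := hG.sum_length
    have h2 := hG.length_le
    simp only [List.sum_map_add, List.map_const', List.sum_replicate, smul_eq_mul,
      List.sum_map_mul_left]
    omega

end Prog

/-! ### Orientations under updates -/

/-- The edges of `E` join distinct vertices below `n`. -/
def SimpleBelow (n : ℕ) (E : Finset (Sym2 ℕ)) : Prop :=
  ∀ e ∈ E, ¬ e.IsDiag ∧ ∀ v ∈ e, v < n

theorem SimpleBelow.applyTo {n : ℕ} {E : Finset (Sym2 ℕ)} (h : SimpleBelow n E) {b : Batch}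
    (hb : b.Legal n E) : SimpleBelow n (b.applyTo E) := by
  cases b with
  | ins B =>
    intro e he
    rcases Finset.mem_union.1 he with he | he
    · exact h e he
    · obtain ⟨f, hf, rfl⟩ := List.mem_map.1 (List.mem_toFinset.1 he)
      obtain ⟨h1, h2, h3⟩ := hb.2.2.1 f hf
      refine ⟨fun hd => h3 (Sym2.mk_isDiag_iff.1 hd), fun v hv => ?_⟩
      rcases Sym2.mem_iff.1 hv with rfl | rfl
      · exact h1
      · exact h2
  | del B => exact fun e he => h e (Finset.mem_sdiff.1 he).1

theorem SimpleBelow.of_undirect_mem {n : ℕ} {E : Finset (Sym2 ℕ)} (h : SimpleBelow n E)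
    {e : ℕ × ℕ} (he : undirect e ∈ E) : e.1 < n ∧ e.2 < n ∧ e.1 ≠ e.2 :=
  ⟨(h _ he).2 _ (Sym2.mem_mk_left _ _), (h _ he).2 _ (Sym2.mem_mk_right _ _),
    fun hd => (h _ he).1 (Sym2.mk_isDiag_iff.2 hd)⟩

namespace IsOrientation

variable {D : Finset (ℕ × ℕ)} {E : Finset (Sym2 ℕ)}

theorem undirect_mem (h : IsOrientation D E) {e : ℕ × ℕ} (he : e ∈ D) : undirect e ∈ E :=
  h.1 ▸ Finset.mem_image_of_mem _ he

theorem mem_or_swap_mem (h : IsOrientation D E) {e : ℕ × ℕ} (he : undirect e ∈ E) :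
    e ∈ D ∨ e.swap ∈ D := by
  rw [← h.1] at he
  obtain ⟨f, hf, hfe⟩ := Finset.mem_image.1 he
  rcases undirect_eq_iff.1 hfe with rfl | rfl
  · exact Or.inl hf
  · exact Or.inr hf

theorem insert_batch (h : IsOrientation D E) {n : ℕ} {B : List (ℕ × ℕ)}
    (hB : (Batch.ins B).Legal n E) :
    IsOrientation (D ∪ B.toFinset) ((Batch.ins B).applyTo E) := by
  refine ⟨?_, ?_⟩
  · rw [Finset.image_union, h.1]
    congr 1
    ext u; simp
  · intro e he hs
    rcases Finset.mem_union.1 he with he | he <;> rcases Finset.mem_union.1 hs with hs | hs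
    · exact h.2 e he hs
    · refine hB.2.2.2 _ (List.mem_toFinset.1 hs) ?_
      rw [undirect_swap]; exact h.undirect_mem he
    · refine hB.2.2.2 _ (List.mem_toFinset.1 he) ?_
      rw [← undirect_swap]; exact h.undirect_mem hs
    · have heB := List.mem_toFinset.1 he
      have hsB := List.mem_toFinset.1 hs
      have := List.inj_on_of_nodup_map hB.2.1 heB hsB (undirect_swap e).symm
      exact (hB.2.2.1 e heB).2.2 (congrArg Prod.fst this)

theorem delete_batch (h : IsOrientation D E) (B : List (ℕ × ℕ)) :
    IsOrientation (D.filter fun e => undirect e ∉ B.map undirect)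
      ((Batch.del B).applyTo E) := by
  refine ⟨?_, ?_⟩
  · ext u
    simp only [Batch.applyTo, Finset.mem_image, Finset.mem_filter, Finset.mem_sdiff,
      List.mem_toFinset]
    constructor
    · rintro ⟨e, ⟨he, hB⟩, rfl⟩
      exact ⟨h.undirect_mem he, hB⟩
    · rintro ⟨hu, hB⟩
      rw [← h.1] at hu
      obtain ⟨e, he, rfl⟩ := Finset.mem_image.1 hu
      exact ⟨e, ⟨he, hB⟩, rfl⟩
  · intro e he hs
    exact h.2 e (Finset.mem_filter.1 he).1 (Finset.mem_filter.1 hs).1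

/-- Replacing the directions of a set of edges. -/
theorem replace (h : IsOrientation D E) {H F : Finset (ℕ × ℕ)} (hH : H ⊆ D)
    (hF : ∀ e ∈ F, e ∈ H ∨ e.swap ∈ H) (hHF : ∀ e ∈ H, e ∈ F ∨ e.swap ∈ F)
    (hasym : ∀ e ∈ F, e.swap ∉ F) : IsOrientation ((D \ H) ∪ F) E := by
  refine ⟨?_, ?_⟩
  · ext u
    simp only [Finset.mem_image, Finset.mem_union, Finset.mem_sdiff]
    constructor
    · rintro ⟨e, ⟨he, -⟩ | he, rfl⟩
      · exact h.undirect_mem he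
      · rcases hF e he with h' | h'
        · exact h.undirect_mem (hH h')
        · rw [← undirect_swap]; exact h.undirect_mem (hH h')
    · intro hu
      rw [← h.1] at hu
      obtain ⟨e, he, rfl⟩ := Finset.mem_image.1 hu
      by_cases heH : e ∈ H
      · rcases hHF e heH with h' | h'
        · exact ⟨e, Or.inr h', rfl⟩
        · exact ⟨e.swap, Or.inr h', undirect_swap e⟩
      · exact ⟨e, Or.inl ⟨he, heH⟩, rfl⟩
  · have hmix : ∀ e ∈ D \ H, e.swap ∉ F := by
      intro e he hs
      rw [Finset.mem_sdiff] at he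
      rcases hF _ hs with h' | h'
      · exact h.2 e he.1 (hH h')
      · exact he.2 (by simpa using h')
    intro e he hs
    rcases Finset.mem_union.1 he with he | he <;> rcases Finset.mem_union.1 hs with hs | hs
    · exact h.2 e (Finset.mem_sdiff.1 he).1 (Finset.mem_sdiff.1 hs).1
    · exact hmix e he hs
    · exact hmix _ hs (by simpa using he)
    · exact hasym e he hs

end IsOrientation

theorem injOn_undirect {D : Finset (ℕ × ℕ)} (h : ∀ e ∈ D, e.swap ∉ D) :
    Set.InjOn undirect (D : Set (ℕ × ℕ)) := by
  intro e he f hf hef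
  rcases undirect_eq_iff.1 hef with h' | h'
  · exact h'
  · exact absurd (h' ▸ he) (h f hf)

theorem card_staticOrientation_le (s : ℕ) (H : Finset (ℕ × ℕ)) :
    (staticOrientation s H).card ≤ H.card := by
  rw [← Finset.card_image_of_injOn (injOn_undirect (swap_notMem_staticOrientation s H))]
  refine (Finset.card_le_card fun u hu => ?_).trans (Finset.card_image_le (f := undirect))
  obtain ⟨e, he, rfl⟩ := Finset.mem_image.1 hu
  rcases mem_or_swap_mem_of_mem_staticOrientation he with h | h
  · exact Finset.mem_image_of_mem _ h
  · exact Finset.mem_image.2 ⟨_, h, undirect_swap e⟩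

theorem highEdges_subset (T : ℕ) (D : Finset (ℕ × ℕ)) : highEdges T D ⊆ D :=
  Finset.filter_subset _ _

theorem algStep_ins_fst (T s : ℕ) (D : Finset (ℕ × ℕ)) (B : List (ℕ × ℕ)) :
    (algStep T s D (.ins B)).1 = ((D ∪ B.toFinset) \ highEdges T (D ∪ B.toFinset)) ∪
      staticOrientation s (highEdges T (D ∪ B.toFinset)) := rfl

theorem algStep_ins_snd (T s : ℕ) (D : Finset (ℕ × ℕ)) (B : List (ℕ × ℕ)) :
    (algStep T s D (.ins B)).2 = (highEdges T (D ∪ B.toFinset) \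
      staticOrientation s (highEdges T (D ∪ B.toFinset))).card := rfl

/-- The number of edges on which an update runs the static orientation. -/
def staticSize (T : ℕ) (D : Finset (ℕ × ℕ)) : Batch → ℕ
  | .ins B => (highEdges T (D ∪ B.toFinset)).card
  | .del _ => 0

/-- Every vertex is the tail of at most `T` edges that keep their direction and of at most `s` newly
directed ones. -/
theorem outdeg_replace_highEdges_le (T s : ℕ) (D : Finset (ℕ × ℕ)) (v : ℕ) :
    outdeg ((D \ highEdges T D) ∪ staticOrientation s (highEdges T D)) v ≤ T + s := by
  refine (outdeg_union_le _ _ v).trans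
    (add_le_add ?_ (outdeg_staticOrientation_le s _ v))
  by_cases hv : outdeg D v ≤ T
  · exact (outdeg_mono Finset.sdiff_subset v).trans hv
  · rw [outdeg_eq_zero]
    · exact Nat.zero_le _
    · rintro e he rfl
      rw [Finset.mem_sdiff] at he
      exact he.2 (Finset.mem_filter.2 ⟨he.1, not_le.1 hv⟩)

section Step

variable {n s q T : ℕ} {E : Finset (Sym2 ℕ)} {D : Finset (ℕ × ℕ)}

theorem mem_staticOrientation_highEdges_or {E₁ : Finset (Sym2 ℕ)} {D₁ : Finset (ℕ × ℕ)}
    (hE : SimpleBelow n E₁) (hD : IsOrientation D₁ E₁)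
    (hs : ∀ A : Finset (ℕ × ℕ), (∀ e ∈ A, undirect e ∈ E₁) → Shrinks s q A) :
    ∀ e ∈ highEdges T D₁, e ∈ staticOrientation s (highEdges T D₁) ∨
      e.swap ∈ staticOrientation s (highEdges T D₁) := by
  intro e he
  have hmem : ∀ e ∈ highEdges T D₁, undirect e ∈ E₁ := fun e he =>
    hD.undirect_mem (highEdges_subset T D₁ he)
  refine mem_staticOrientation_or (fun e he => (hE.of_undirect_mem (hmem e he)).2.2)
    (hs _ fun f hf => ?_) he
  simp only [Finset.mem_union, Finset.mem_image] at hf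
  rcases hf with h | ⟨g, hg, rfl⟩
  · exact hmem f h
  · rw [undirect_swap]; exact hmem g hg

/-- One update maintains an orientation of the graph. -/
theorem isOrientation_algStep {b : Batch} (hE : SimpleBelow n E) (hD : IsOrientation D E)
    (hb : b.Legal n E)
    (hs : ∀ A : Finset (ℕ × ℕ), (∀ e ∈ A, undirect e ∈ b.applyTo E) → Shrinks s q A) :
    IsOrientation (algStep T s D b).1 (b.applyTo E) := by
  cases b with
  | ins B =>
    have hD₁ := hD.insert_batch hb
    exact hD₁.replace (highEdges_subset T _) (fun e => mem_or_swap_mem_of_mem_staticOrientation)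
      (mem_staticOrientation_highEdges_or (hE.applyTo hb) hD₁ hs)
      (swap_notMem_staticOrientation s _)
  | del B => exact hD.delete_batch B

/-! ### The update program -/

namespace Prog

/-- Reading all out-edges of the vertices in the bag `high`. -/
theorem spec_collectHigh {m : Mem} (h : Holds n m D (highSet T n D)) (hlt : ∀ e ∈ D, e.1 < n) :
    (do
      let V ← bagPeek .high
      collect (fun u => do
        let X ← bagPeek (.out u)
        collect (fun v => pure [(u, v)]) X) V : Prog (List (ℕ × ℕ))).Spec m
      (fun A m' => m' = m ∧ A.Nodup ∧ A.toFinset = highEdges T D)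
      (11 * (highEdges T D).card + 1) := by
  set L := bagList m .high with hL
  have hmem : ∀ u, u ∈ L ↔ u < n ∧ T < outdeg D u := by
    intro u; rw [h.high.mem_bagList]; simp [highSet]
  have hLnd : L.Nodup := h.high.nodup_bagList
  have hlist : (L.flatMap fun u => (bagList m (.out u)).map (Prod.mk u)).Nodup ∧
      (L.flatMap fun u => (bagList m (.out u)).map (Prod.mk u)).toFinset = highEdges T D := by
    refine ⟨?_, ?_⟩
    · rw [List.nodup_flatMap]
      refine ⟨fun u _ => (h.out u).nodup_bagList.map (Prod.mk_right_injective u), ?_⟩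
      refine List.Pairwise.imp_of_mem ?_ hLnd
      intro u v _ _ huv e heu hev
      obtain ⟨x, -, rfl⟩ := List.mem_map.1 heu
      obtain ⟨y, -, hy⟩ := List.mem_map.1 hev
      exact huv (congrArg Prod.fst hy).symm
    · ext ⟨u, v⟩
      simp only [List.mem_toFinset, List.mem_flatMap, List.mem_map, Prod.mk.injEq, highEdges,
        Finset.mem_filter]
      constructor
      · rintro ⟨u', hu', v', hv', rfl, rfl⟩
        rw [(h.out u').mem_bagList, mem_heads] at hv'
        exact ⟨hv', ((hmem u').1 hu').2⟩
      · rintro ⟨huv, hT⟩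
        exact ⟨u, (hmem u).2 ⟨hlt _ huv, hT⟩, v,
          (h.out u).mem_bagList.2 (mem_heads.2 huv), rfl, rfl⟩
  have hsum : (L.map fun u => outdeg D u).sum = (highEdges T D).card := by
    rw [← hlist.2, List.toFinset_card_of_nodup hlist.1, List.length_flatMap]
    congr 1
    refine List.map_congr_left fun u _ => ?_
    rw [List.length_map, (h.out u).length_bagList, card_heads]
  have hLlen : L.length ≤ (highEdges T D).card := by
    rw [← hsum]
    refine (List.length_le_sum_of_one_le _ ?_).trans' (by simp)
    intro d hd
    obtain ⟨u, hu, rfl⟩ := List.mem_map.1 hd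
    have := ((hmem u).1 hu).2
    omega
  refine Spec.mono_cost (c := (3 * L.length + 1) + (6 * (highEdges T D).card + 2 * L.length)) ?_
    (by omega)
  refine Spec.bind ((spec_bagPeek h.high).mono_cost (by rw [hL, h.high.length_bagList])) ?_
  rintro _ m ⟨rfl, rfl⟩
  refine Spec.mono (Spec.collect (fun u => (bagList m (.out u)).map (Prod.mk u))
    (fun u => 5 * outdeg D u + 1) L ?_) ?_ ?_
  · intro u _
    refine Spec.mono_cost (c := (3 * outdeg D u + 1) + 2 * outdeg D u) ?_ (by omega)
    refine Spec.bind ((spec_bagPeek (h.out u)).mono_cost (by rw [card_heads])) ?_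
    rintro _ _ ⟨rfl, rfl⟩
    refine Spec.mono (Spec.collect (fun v => [(u, v)]) (fun _ => 0) _
      fun v _ => Spec.pure ⟨rfl, rfl⟩) ?_ ?_
    · rintro _ _ ⟨rfl, rfl⟩
      exact ⟨by rw [List.map_eq_flatMap], rfl⟩
    · simp [(h.out u).length_bagList, card_heads, mul_comm]
  · rintro _ _ ⟨rfl, rfl⟩
    exact ⟨rfl, hlist⟩
  · have h1 : ∀ u, ((bagList m (.out u)).map (Prod.mk u)).length = outdeg D u := fun u => by
      rw [List.length_map, (h.out u).length_bagList, card_heads]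
    simp only [h1, List.sum_map_add, List.sum_map_mul_left, hsum, List.map_const',
      List.sum_replicate, smul_eq_mul]
    omega

/-- The part of an insertion that follows the addition of the new edges: the out-edges of the
vertices in the bag `high` are read, given new directions, and stored again where they changed. -/
theorem spec_reorient {p : ℕ} (hp : p.Prime) (hnp : n ≤ p) (hq : 1 ≤ q) {m : Mem}
    (hE : SimpleBelow n E) (hD : IsOrientation D E)
    (hs : ∀ A : Finset (ℕ × ℕ), (∀ e ∈ A, undirect e ∈ E) → Shrinks s q A)
    (h : Holds n m D (highSet T n D)) :
    (do
      let V ← bagPeek .high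
      let H ← collect (fun u => do
        let X ← bagPeek (.out u)
        collect (fun v => pure [(u, v)]) X) V
      let F ← staticOrient p s H
      let X ← select (fun e => do
        let d ← get (.dir e.1 e.2)
        pure (decide (d = 0))) F
      let Y ← swapAll X
      removeEdges p T Y
      addEdges p T X : Prog Unit).Spec m
      (fun _ m' => Holds n m' ((D \ highEdges T D) ∪ staticOrientation s (highEdges T D))
        (highSet T n ((D \ highEdges T D) ∪ staticOrientation s (highEdges T D))))
      (140 * (q * (highEdges T D).card) + 6) := by
  have hcoll := spec_collectHigh h fun e he => (hE.of_undirect_mem (hD.undirect_mem he)).1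
  have hHF := mem_staticOrientation_highEdges_or (T := T) hE hD hs
  have hHD : highEdges T D ⊆ D := highEdges_subset T D
  generalize highEdges T D = H at *
  have hFH : ∀ e ∈ staticOrientation s H, e ∈ H ∨ e.swap ∈ H := fun e =>
    mem_or_swap_mem_of_mem_staticOrientation
  have hFasym := swap_notMem_staticOrientation s H
  have hFcard := card_staticOrientation_le s H
  have hstat := fun A hAnd hlt hasym hsh m hm => spec_staticOrient (s := s) hp hq A m hAnd hlt
    hasym hsh hm
  obtain ⟨F, hF⟩ : ∃ F, staticOrientation s H = F := ⟨_, rfl⟩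
  rw [hF] at hHF hFH hFasym hFcard ⊢
  have hmemH : ∀ e ∈ H, undirect e ∈ E := fun e he => hD.undirect_mem (hHD he)
  have hbelow : ∀ e ∈ H, e.1 < n ∧ e.2 < n := fun e he =>
    ⟨(hE.of_undirect_mem (hmemH e he)).1, (hE.of_undirect_mem (hmemH e he)).2.1⟩
  have hFbelow : ∀ e ∈ F, e.1 < n ∧ e.2 < n := by
    intro e he
    rcases hFH e he with h' | h'
    · exact hbelow e h'
    · exact (hbelow _ h').symm
  have hmemD : ∀ e ∈ F, e ∈ D → e ∈ H := by
    intro e he heD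
    rcases hFH e he with h' | h'
    · exact h'
    · exact absurd (hHD h') (hD.2 e heD)
  have hqH : H.card ≤ q * H.card := Nat.le_mul_of_pos_left _ hq
  refine Spec.mono_cost (c := (11 * H.card + 1) +
    ((57 * (q * H.card) + 1) + ((1 + 1) * H.card + (2 * H.card + ((34 * H.card + 2) +
      (32 * H.card + 2)))))) ?_ (by omega)
  have hassoc : ∀ (p₀ : Prog (List ℕ)) (f : List ℕ → Prog (List (ℕ × ℕ)))
      (k : List (ℕ × ℕ) → Prog Unit),
      (p₀ >>= fun V => f V >>= k) = ((p₀ >>= f) >>= k) := fun p₀ f k =>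
    (seqBind_assoc p₀ f k).symm
  rw [hassoc]
  refine Spec.bind hcoll ?_
  rintro A m ⟨rfl, hAnd, hA⟩
  have hAlen : A.length = H.card := by rw [← List.toFinset_card_of_nodup hAnd, hA]
  have hAmem : ∀ e, e ∈ A ↔ e ∈ H := fun e => by rw [← List.mem_toFinset, hA]
  refine Spec.bind ((hstat A hAnd (fun e he => ?_) (fun e he he' => ?_) (hs _ fun e he => ?_)
    m h.mark).mono_cost (by rw [hAlen])) ?_
  · have := hbelow e ((hAmem e).1 he)
    exact ⟨this.1.trans_le hnp, this.2.trans_le hnp⟩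
  · exact hD.2 e (hHD ((hAmem e).1 he)) (hHD ((hAmem _).1 he'))
  · rw [hA] at he
    simp only [Finset.mem_union, Finset.mem_image] at he
    rcases he with he | ⟨f, hf, rfl⟩
    · exact hmemH e he
    · rw [undirect_swap]; exact hmemH f hf
  rintro Y m₂ ⟨hw₂, hYnd, hY⟩
  rw [hA, hF] at hY
  have h₂ := h.congr hw₂
  have hYlen : Y.length ≤ H.card := by
    rw [← List.toFinset_card_of_nodup hYnd, hY]; exact hFcard
  have hYmem : ∀ e, e ∈ Y ↔ e ∈ F := fun e => by rw [← List.mem_toFinset, hY]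
  refine Spec.bind ((Spec.select (fun e => decide (m₂.word (.dir e.1 e.2) = 0)) 1 Y
    fun e _ => Spec.get_bind (Spec.pure ⟨rfl, rfl⟩)).mono_cost
      (Nat.mul_le_mul_left _ hYlen)) ?_
  rintro X m₂ ⟨hX, rfl⟩
  have hXnd : X.Nodup := hX ▸ hYnd.filter _
  have hXlen : X.length ≤ H.card := by
    rw [hX]; exact (List.length_filter_le _ _).trans hYlen
  have hXmem : ∀ e, e ∈ X ↔ e ∈ F ∧ e ∉ D := by
    intro e
    rw [hX, List.mem_filter, hYmem, decide_eq_true_eq, h₂.dir]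
    split_ifs with h' <;> simpa using fun _ => h'
  clear hX
  refine Spec.bind ((spec_swapAll X m₂).mono_cost (Nat.mul_le_mul_left _ hXlen)) ?_
  rintro _ m₂ ⟨rfl, rfl⟩
  have hZmem : ∀ e, e ∈ X.map Prod.swap ↔ e ∈ H ∧ e ∉ F := by
    intro e
    rw [List.mem_map]
    constructor
    · rintro ⟨f, hf, rfl⟩
      obtain ⟨hfF, hfD⟩ := (hXmem f).1 hf
      exact ⟨(hFH f hfF).resolve_left fun h' => hfD (hHD h'), hFasym f hfF⟩
    · rintro ⟨heH, heF⟩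
      exact ⟨e.swap, (hXmem _).2 ⟨(hHF e heH).resolve_left heF, hD.2 e (hHD heH)⟩,
        Prod.swap_swap e⟩
  refine Spec.bind ((spec_removeEdges hp hnp h₂ (X.map Prod.swap)
    (hXnd.map Prod.swap_injective) (fun e he => (hbelow e ((hZmem e).1 he).1).1)
    (fun e he => hHD ((hZmem e).1 he).1)).mono_cost (by rw [List.length_map]; omega)) ?_
  rintro - m₃ h₃
  refine (spec_addEdges hp hnp h₃ X hXnd (fun e he => (hFbelow e ((hXmem e).1 he).1).1)
    (fun e he heD => ((hXmem e).1 he).2 (Finset.mem_sdiff.1 heD).1)).mono ?_ (by omega)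
  rintro - m₄ h₄
  have hfinal : (D \ (X.map Prod.swap).toFinset) ∪ X.toFinset = (D \ H) ∪ F := by
    ext e
    simp only [Finset.mem_union, Finset.mem_sdiff, List.mem_toFinset, hZmem, hXmem]
    have h5 := hmemD e
    have h6 : e ∈ H → e ∈ D := fun h' => hHD h'
    tauto
  rwa [hfinal] at h₄

/-- One update of the program performs one update of the orientation, in expected time linear in the
batch and in the number of edges on which the static orientation is run. -/
theorem spec_update {p : ℕ} (hp : p.Prime) (hnp : n ≤ p) (hq : 1 ≤ q) {b : Batch} {m : Mem}
    (hE : SimpleBelow n E) (hD : IsOrientation D E) (hb : b.Legal n E)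
    (hs : ∀ A : Finset (ℕ × ℕ), (∀ e ∈ A, undirect e ∈ b.applyTo E) → Shrinks s q A)
    (h : Holds n m D (highSet T n D)) :
    (update p T s b).Spec m
      (fun _ m' => Holds n m' (algStep T s D b).1 (highSet T n (algStep T s D b).1))
      (42 * b.edges.length + 140 * (q * staticSize T D b)) := by
  have hlen : 1 ≤ b.edges.length := List.length_pos_of_ne_nil hb.1
  cases b with
  | ins B =>
    have hBnd : B.Nodup := List.Nodup.of_map _ hb.2.1
    change 1 ≤ B.length at hlen
    refine Spec.mono_cost (c := (32 * B.length + 2) +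
      (140 * (q * (highEdges T (D ∪ B.toFinset)).card) + 6)) ?_ (by
        simp only [Batch.edges, staticSize]; omega)
    refine Spec.bind (spec_addEdges hp hnp h B hBnd (fun e he => (hb.2.2.1 e he).1)
      (fun e he heD => hb.2.2.2 e he (hD.undirect_mem heD))) ?_
    rintro - m₁ h₁
    exact spec_reorient hp hnp hq (hE.applyTo hb) (hD.insert_batch hb) hs h₁
  | del B =>
    change Spec _ m _ (42 * B.length + 140 * (q * 0))
    change 1 ≤ B.length at hlen
    refine Spec.mono_cost (c := 3 * B.length + (34 * B.length + 2)) ?_ (by omega)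
    let g : ℕ × ℕ → ℕ × ℕ := fun e => if e ∈ D then e else e.swap
    have hgu : ∀ e, undirect (g e) = undirect e := by
      intro e; simp only [g]; split_ifs
      · rfl
      · exact undirect_swap e
    have hgD : ∀ e ∈ B, g e ∈ D := by
      intro e he
      simp only [g]
      split_ifs with h'
      · exact h'
      · exact (hD.mem_or_swap_mem (hb.2.2.2 e he)).resolve_left h'
    have hnd : (B.map g).Nodup := by
      refine List.Nodup.of_map undirect ?_
      rw [List.map_map]
      have : undirect ∘ g = undirect := funext hgu
      rw [this]; exact hb.2.1
    have hmem : ∀ e, e ∈ B.map g ↔ e ∈ D ∧ undirect e ∈ B.map undirect := by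
      intro e
      rw [List.mem_map, List.mem_map]
      constructor
      · rintro ⟨f, hf, rfl⟩
        exact ⟨hgD f hf, f, hf, (hgu f).symm⟩
      · rintro ⟨heD, f, hf, hfe⟩
        exact ⟨f, hf, injOn_undirect hD.2 (hgD f hf) heD ((hgu f).trans hfe)⟩
    have hg : ∀ e : ℕ × ℕ, [if m.word (.dir e.1 e.2) = 1 then e else e.swap] = [g e] := by
      intro e
      rw [h.dir]
      by_cases he : e ∈ D <;> simp [g, he]
    refine Spec.bind ((Spec.collect (fun e => [g e]) (fun _ => 1) B fun e _ =>
      Spec.get_bind (Spec.pure ⟨hg e, rfl⟩)).mono_cost (by simp [mul_comm])) ?_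
    rintro _ m ⟨rfl, rfl⟩
    rw [← List.map_eq_flatMap]
    refine (spec_removeEdges hp hnp h (B.map g) hnd
      (fun e he => (hE.of_undirect_mem (hD.undirect_mem ((hmem e).1 he).1)).1)
      (fun e he => ((hmem e).1 he).1)).mono ?_ (by rw [List.length_map])
    rintro - m' h'
    have hfinal : D \ (B.map g).toFinset = (algStep T s D (.del B)).1 := by
      change _ = D.filter fun e => undirect e ∉ B.map undirect
      ext e
      rw [Finset.mem_sdiff, List.mem_toFinset, hmem, Finset.mem_filter]
      tauto
    rwa [hfinal] at h'

end Prog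

end Step

/-! ### Amortization against a strategy -/

theorem card_le_mul_of_outdeg_le {A : Finset (ℕ × ℕ)} {V : Finset ℕ} {k : ℕ}
    (hV : ∀ e ∈ A, e.1 ∈ V) (hk : ∀ v, outdeg A v ≤ k) : A.card ≤ k * V.card :=
  Finset.card_le_mul_card_image_of_maps_to (f := Prod.fst) hV k fun v _ => hk v

/-- The vertices of out-degree greater than `T`. -/
def highTails (T : ℕ) (D : Finset (ℕ × ℕ)) : Finset ℕ := (highEdges T D).image Prod.fst

theorem succ_mul_card_highTails_le (T : ℕ) (D : Finset (ℕ × ℕ)) :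
    (T + 1) * (highTails T D).card ≤ (highEdges T D).card := by
  refine Finset.mul_card_image_le_card_of_maps_to (f := Prod.fst)
    (fun e he => Finset.mem_image_of_mem _ he) _ ?_
  intro v hv
  obtain ⟨e, he, rfl⟩ := Finset.mem_image.1 hv
  have hT := (Finset.mem_filter.1 he).2
  refine (Nat.succ_le_of_lt hT).trans (Finset.card_le_card fun f hf => ?_)
  rw [Finset.mem_filter] at hf ⊢
  refine ⟨Finset.mem_filter.2 ⟨hf.1, ?_⟩, hf.2⟩
  rw [hf.2]; exact hT

theorem fst_mem_highTails {T : ℕ} {D : Finset (ℕ × ℕ)} {e : ℕ × ℕ} (he : e ∈ highEdges T D) :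
    e.1 ∈ highTails T D := Finset.mem_image_of_mem _ he

/-- A high vertex keeps at most `s` of its out-edges; the others are flipped. -/
theorem card_highEdges_le_flips (T s : ℕ) (D : Finset (ℕ × ℕ)) :
    (highEdges T D).card ≤ (highEdges T D \ staticOrientation s (highEdges T D)).card +
      s * (highTails T D).card := by
  rw [← Finset.card_sdiff_add_card_inter (highEdges T D) (staticOrientation s (highEdges T D))]
  refine Nat.add_le_add_left (card_le_mul_of_outdeg_le
    (fun e he => fst_mem_highTails (Finset.mem_inter.1 he).1) fun v => ?_) _
  exact (outdeg_mono Finset.inter_subset_right v).trans (outdeg_staticOrientation_le s _ v)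

/-- The number of edges of `D` that `P` directs the other way: the potential of the amortized
analysis, with `P` the orientation of the strategy. -/
def disagreements (D P : Finset (ℕ × ℕ)) : ℕ := (D.filter fun e => e.swap ∈ P).card

theorem disagreements_mono {D D' : Finset (ℕ × ℕ)} (h : D ⊆ D') (P : Finset (ℕ × ℕ)) :
    disagreements D P ≤ disagreements D' P :=
  Finset.card_le_card (Finset.filter_subset_filter _ h)

theorem disagreements_le_card (D P : Finset (ℕ × ℕ)) : disagreements D P ≤ D.card :=
  Finset.card_filter_le _ _

theorem disagreements_union_le (D D' P : Finset (ℕ × ℕ)) :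
    disagreements (D ∪ D') P ≤ disagreements D P + disagreements D' P := by
  rw [disagreements, Finset.filter_union]
  exact Finset.card_union_le _ _

/-- A flip of the strategy adds at most one disagreement. -/
theorem disagreements_le_add {E : Finset (Sym2 ℕ)} {D P P' : Finset (ℕ × ℕ)}
    (hD : IsOrientation D E) (hP : IsOrientation P E) :
    disagreements D P' ≤ disagreements D P + disagreements P P' := by
  refine (Finset.card_le_card fun e he => ?_).trans (Finset.card_union_le _ _)
  obtain ⟨heD, heP'⟩ := Finset.mem_filter.1 he
  rw [Finset.mem_union]
  rcases hP.mem_or_swap_mem (hD.undirect_mem heD) with h | h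
  · exact Or.inr (Finset.mem_filter.2 ⟨h, heP'⟩)
  · exact Or.inl (Finset.mem_filter.2 ⟨heD, h⟩)

/-- The effect of a static orientation step on the potential.  Of the processed edges, those that do
not disagree with `P` are out-edges in `P` of high vertices.  The disagreements that the step leaves
among them are out-edges of high vertices either in the new orientation or, reversed, in `P`. -/
theorem disagreements_replace_le {T s k : ℕ} {E : Finset (Sym2 ℕ)} {D P : Finset (ℕ × ℕ)}
    (hD : IsOrientation D E) (hP : IsOrientation P E) (hk : ∀ v, outdeg P v ≤ k) :
    disagreements ((D \ highEdges T D) ∪ staticOrientation s (highEdges T D)) P +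
      (highEdges T D).card ≤ disagreements D P + (s + 2 * k) * (highTails T D).card := by
  have hHD : highEdges T D ⊆ D := highEdges_subset T D
  have hV : ∀ e ∈ highEdges T D, e.1 ∈ highTails T D := fun e => fst_mem_highTails
  generalize highTails T D = V at *
  generalize highEdges T D = H at *
  have hsplit : disagreements (D \ H) P + disagreements H P = disagreements D P := by
    rw [disagreements, disagreements, disagreements, ← Finset.card_union_of_disjoint,
      ← Finset.filter_union, Finset.sdiff_union_of_subset hHD]
    exact Finset.disjoint_filter_filter Finset.sdiff_disjoint
  have hPk : ∀ A : Finset (ℕ × ℕ), A ⊆ P → (∀ e ∈ A, e.1 ∈ V) → A.card ≤ k * V.card :=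
    fun A hA hAV => card_le_mul_of_outdeg_le hAV fun v => (outdeg_mono hA v).trans (hk v)
  have h1 : H.card ≤ disagreements H P + k * V.card := by
    refine le_trans ?_ (Nat.add_le_add_left (hPk (H.filter fun e => e ∈ P)
      (fun e he => (Finset.mem_filter.1 he).2) fun e he => hV e (Finset.mem_filter.1 he).1) _)
    refine (Finset.card_le_card fun e he => ?_).trans (Finset.card_union_le _ _)
    rw [Finset.mem_union, Finset.mem_filter, Finset.mem_filter]
    rcases hP.mem_or_swap_mem (hD.undirect_mem (hHD he)) with h | h
    · exact Or.inr ⟨he, h⟩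
    · exact Or.inl ⟨he, h⟩
  have h2 : disagreements (staticOrientation s H) P ≤ s * V.card + k * V.card := by
    have hs : ((staticOrientation s H).filter fun e => e.1 ∈ V).card ≤ s * V.card :=
      card_le_mul_of_outdeg_le (fun e he => (Finset.mem_filter.1 he).2) fun v =>
        (outdeg_mono (Finset.filter_subset _ _) v).trans (outdeg_staticOrientation_le s H v)
    have hk' : ((H.filter fun e => e ∈ P).image Prod.swap).card ≤ k * V.card :=
      Finset.card_image_le.trans (hPk _ (fun e he => (Finset.mem_filter.1 he).2)
        fun e he => hV e (Finset.mem_filter.1 he).1)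
    refine le_trans ?_ (add_le_add hs hk')
    refine (Finset.card_le_card fun e he => ?_).trans (Finset.card_union_le _ _)
    obtain ⟨heF, heP⟩ := Finset.mem_filter.1 he
    rw [Finset.mem_union, Finset.mem_filter, Finset.mem_image]
    rcases mem_or_swap_mem_of_mem_staticOrientation heF with h | h
    · exact Or.inl ⟨heF, hV e h⟩
    · exact Or.inr ⟨e.swap, Finset.mem_filter.2 ⟨h, heP⟩, Prod.swap_swap e⟩
  have h3 := disagreements_union_le (D \ H) (staticOrientation s H) P
  have h4 : (s + 2 * k) * V.card = s * V.card + k * V.card + k * V.card := by ring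
  omega

/-- With `v` high vertices and `h` processed edges, the potential drops by at least
`h - (s + 2 k) v` in a static orientation step, and `K` times this drop is at least `h`. -/
def Pays (K T s k : ℕ) : Prop :=
  ∀ h v : ℕ, (T + 1) * v ≤ h → h + K * ((s + 2 * k) * v) ≤ K * h

theorem exists_pays {α ε θ : ℝ} (hα : 0 < α) (hε : 0 < ε) (hθ : 2 * α + 2 + ε < θ) :
    ∃ K : ℕ, ∀ c : ℕ, Pays K ⌊θ * c⌋₊ ⌊(2 + ε) * c⌋₊ ⌊α * c⌋₊ := by
  have hpos : 0 < θ - (2 * α + 2 + ε) := by linarith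
  have hθ0 : 0 < θ := by linarith
  refine ⟨⌈θ / (θ - (2 * α + 2 + ε))⌉₊, fun c h v hv => ?_⟩
  have hK : θ / (θ - (2 * α + 2 + ε)) ≤ ⌈θ / (θ - (2 * α + 2 + ε))⌉₊ := Nat.le_ceil _
  generalize ⌈θ / (θ - (2 * α + 2 + ε))⌉₊ = K at *
  rw [div_le_iff₀ hpos] at hK
  have hc : (0 : ℝ) ≤ c := Nat.cast_nonneg c
  have hv0 : (0 : ℝ) ≤ v := Nat.cast_nonneg v
  have hK0 : (0 : ℝ) ≤ K := Nat.cast_nonneg K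
  have hh0 : (0 : ℝ) ≤ h := Nat.cast_nonneg h
  have h1 : θ * c ≤ ⌊θ * c⌋₊ + 1 := (Nat.lt_floor_add_one _).le
  have h2 : (⌊(2 + ε) * c⌋₊ : ℝ) ≤ (2 + ε) * c := Nat.floor_le (by positivity)
  have h3 : (⌊α * c⌋₊ : ℝ) ≤ α * c := Nat.floor_le (by positivity)
  have hv' : ((⌊θ * c⌋₊ : ℝ) + 1) * v ≤ h := by exact_mod_cast hv
  have h4 : θ * (c * v) ≤ h := by
    calc θ * (c * v) = θ * c * v := by ring
      _ ≤ (⌊θ * c⌋₊ + 1) * v := by gcongr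
      _ ≤ h := hv'
  have h5 : ((⌊(2 + ε) * c⌋₊ : ℝ) + 2 * ⌊α * c⌋₊) * v ≤ (2 * α + 2 + ε) * (c * v) := by
    calc ((⌊(2 + ε) * c⌋₊ : ℝ) + 2 * ⌊α * c⌋₊) * v ≤ ((2 + ε) * c + 2 * (α * c)) * v := by gcongr
      _ = (2 * α + 2 + ε) * (c * v) := by ring
  have h6 : θ * ((h : ℝ) + K * (((⌊(2 + ε) * c⌋₊ : ℝ) + 2 * ⌊α * c⌋₊) * v)) ≤ θ * (K * h) := by
    calc θ * ((h : ℝ) + K * (((⌊(2 + ε) * c⌋₊ : ℝ) + 2 * ⌊α * c⌋₊) * v))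
        ≤ θ * ((h : ℝ) + K * ((2 * α + 2 + ε) * (c * v))) := by gcongr
      _ = θ * h + K * (2 * α + 2 + ε) * (θ * (c * v)) := by ring
      _ ≤ θ * h + K * (2 * α + 2 + ε) * h := by gcongr
      _ ≤ K * (θ - (2 * α + 2 + ε)) * h + K * (2 * α + 2 + ε) * h := by gcongr
      _ = θ * (K * h) := by ring
  have h7 := le_of_mul_le_mul_left h6 hθ0
  exact_mod_cast h7

/-- The processed edges are at most a constant times the flips. -/
theorem staticSize_le {K T s k : ℕ} (hK : Pays K T s k) (D : Finset (ℕ × ℕ)) (b : Batch) :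
    staticSize T D b ≤ K * (algStep T s D b).2 := by
  cases b with
  | ins B =>
    rw [algStep_ins_snd, staticSize]
    have h1 := card_highEdges_le_flips T s (D ∪ B.toFinset)
    have h2 := hK _ _ (succ_mul_card_highTails_le T (D ∪ B.toFinset))
    have h3 := Nat.mul_le_mul_left K h1
    have h4 : s * (highTails T (D ∪ B.toFinset)).card ≤
        (s + 2 * k) * (highTails T (D ∪ B.toFinset)).card :=
      Nat.mul_le_mul_right _ (Nat.le_add_right _ _)
    have h5 := Nat.mul_le_mul_left K h4
    rw [mul_add] at h3
    omega
  | del B => exact Nat.zero_le _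

theorem algStep_snd_le_staticSize (T s : ℕ) (D : Finset (ℕ × ℕ)) (b : Batch) :
    (algStep T s D b).2 ≤ staticSize T D b := by
  cases b with
  | ins B => exact Finset.card_le_card Finset.sdiff_subset
  | del B => exact le_rfl

/-- The amortized cost of one update. -/
theorem flips_add_disagreements_le {K T s k n : ℕ} (hK : Pays K T s k) {E : Finset (Sym2 ℕ)}
    {D P P' : Finset (ℕ × ℕ)} {b : Batch} (hb : b.Legal n E) (hD : IsOrientation D E)
    (hP : IsOrientation P E) (hP' : IsOrientation P' (b.applyTo E)) (hk : ∀ v, outdeg P' v ≤ k) :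
    (algStep T s D b).2 + K * disagreements (algStep T s D b).1 P' ≤
      K * (disagreements D P + b.numIns + disagreements P P') := by
  have h0 := disagreements_le_add (P' := P') hD hP
  cases b with
  | ins B =>
    have h1 := disagreements_union_le D B.toFinset P'
    have h2 : disagreements B.toFinset P' ≤ B.length :=
      (disagreements_le_card _ _).trans (List.toFinset_card_le _)
    have h3 := disagreements_replace_le (T := T) (s := s) (hD.insert_batch hb) hP' hk
    rw [← algStep_ins_fst] at h3
    have h4 := hK _ _ (succ_mul_card_highTails_le T (D ∪ B.toFinset))
    have h5 := algStep_snd_le_staticSize T s D (.ins B)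
    simp only [staticSize] at h5
    have h6 := Nat.mul_le_mul_left K h3
    have h7 : K * disagreements (D ∪ B.toFinset) P' ≤
        K * (disagreements D P + B.length + disagreements P P') :=
      Nat.mul_le_mul_left K (by omega)
    rw [mul_add, mul_add K (disagreements _ _)] at h6
    change _ ≤ K * (disagreements D P + B.length + disagreements P P')
    omega
  | del B =>
    have h1 : disagreements (algStep T s D (.del B)).1 P' ≤ disagreements D P' :=
      disagreements_mono (Finset.filter_subset _ _) _
    change 0 + _ ≤ K * (disagreements D P + 0 + disagreements P P')
    rw [zero_add]
    exact Nat.mul_le_mul_left K (by omega)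

/-! ### The work of a strategy -/

theorem exists_unit_of_changed {state : ℕ → Finset (ℕ × ℕ)} {a : ℕ → Sym2 ℕ}
    (ha : ∀ j, ∀ e ∈ state j ∆ state (j + 1), undirect e = a j) {t t' : ℕ} (htt : t ≤ t')
    {e : ℕ × ℕ} (he : ¬ (e ∈ state t ↔ e ∈ state t')) :
    undirect e ∈ (Finset.Ico t t').image a := by
  induction t', htt using Nat.le_induction with
  | base => exact absurd Iff.rfl he
  | succ j hj ih =>
    by_cases h : e ∈ state t ↔ e ∈ state j
    · refine Finset.mem_image.2 ⟨j, Finset.mem_Ico.2 ⟨hj, Nat.lt_succ_self j⟩, (ha j e ?_).symm⟩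
      rw [Finset.mem_symmDiff]
      tauto
    · obtain ⟨i, hi, hia⟩ := Finset.mem_image.1 (ih h)
      rw [Finset.mem_Ico] at hi
      exact Finset.mem_image.2 ⟨i, Finset.mem_Ico.2 ⟨hi.1, by omega⟩, hia⟩

/-- The edges of a batch and the edges reversed along with it are different, and all of them have to
be touched. -/
theorem Batch.length_add_flips_le {state : ℕ → Finset (ℕ × ℕ)}
    (hunit : ∀ j, ∃ a : Sym2 ℕ, ∀ e ∈ state j ∆ state (j + 1), undirect e = a) {t t' n : ℕ}
    (htt : t ≤ t') {E : Finset (Sym2 ℕ)} {b : Batch} (hb : b.Legal n E)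
    (h : IsOrientation (state t) E) (h' : IsOrientation (state t') (b.applyTo E)) :
    b.edges.length + disagreements (state t) (state t') ≤ t' - t := by
  choose a ha using hunit
  have hmem : ∀ u, (u ∈ E ∧ u ∉ b.applyTo E) ∨ (u ∉ E ∧ u ∈ b.applyTo E) →
      u ∈ (Finset.Ico t t').image a := by
    rintro u (⟨hu, hu'⟩ | ⟨hu, hu'⟩)
    · have hu₀ := hu
      rw [← h.1] at hu₀
      obtain ⟨e, he, rfl⟩ := Finset.mem_image.1 hu₀
      exact exists_unit_of_changed ha htt fun hiff => hu' (h'.undirect_mem (hiff.1 he))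
    · have hu₀ := hu'
      rw [← h'.1] at hu₀
      obtain ⟨e, he, rfl⟩ := Finset.mem_image.1 hu₀
      exact exists_unit_of_changed ha htt fun hiff => hu (h.undirect_mem (hiff.2 he))
  have hbatch : ∀ u ∈ b.edges.map undirect,
      (u ∈ E ∧ u ∉ b.applyTo E) ∨ (u ∉ E ∧ u ∈ b.applyTo E) := by
    intro u hu
    obtain ⟨e, he, rfl⟩ := List.mem_map.1 hu
    cases b with
    | ins B => exact Or.inr ⟨hb.2.2.2 e he, Finset.mem_union_right _ (List.mem_toFinset.2 hu)⟩
    | del B =>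
      exact Or.inl ⟨hb.2.2.2 e he, fun hu' => (Finset.mem_sdiff.1 hu').2 (List.mem_toFinset.2 hu)⟩
  have hcard₁ : (b.edges.map undirect).toFinset.card = b.edges.length := by
    rw [List.toFinset_card_of_nodup hb.2.1, List.length_map]
  have hcard₂ : (((state t).filter fun e => e.swap ∈ state t').image undirect).card =
      disagreements (state t) (state t') := by
    rw [disagreements, Finset.card_image_of_injOn]
    exact (injOn_undirect h.2).mono (Finset.filter_subset _ _)
  rw [← hcard₁, ← hcard₂, ← Finset.card_union_of_disjoint]
  · have hle : ((Finset.Ico t t').image a).card ≤ t' - t :=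
      Finset.card_image_le.trans (by simp)
    refine (Finset.card_le_card fun u hu => ?_).trans hle
    rcases Finset.mem_union.1 hu with hu | hu
    · exact hmem u (hbatch u (List.mem_toFinset.1 hu))
    · obtain ⟨e, he, rfl⟩ := Finset.mem_image.1 hu
      obtain ⟨he, hes⟩ := Finset.mem_filter.1 he
      refine exists_unit_of_changed ha htt fun hiff => h'.2 e (hiff.1 he) hes
  · rw [Finset.disjoint_left]
    intro u hu hu'
    obtain ⟨e, he, rfl⟩ := Finset.mem_image.1 hu'
    obtain ⟨he, hes⟩ := Finset.mem_filter.1 he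
    have h1 := h.undirect_mem he
    have h2 := h'.undirect_mem hes
    rw [undirect_swap] at h2
    have := hbatch _ (List.mem_toFinset.1 hu)
    tauto

/-! ### Sequences of batches -/

theorem algRun_append_singleton (T s : ℕ) (seq : List Batch) (b : Batch) :
    algRun T s (seq ++ [b]) = ((algStep T s (algOrientation T s seq) b).1,
      algFlips T s seq + (algStep T s (algOrientation T s seq) b).2) := by
  rw [algRun, List.foldl_append]; rfl

theorem algOrientation_take_succ (T s : ℕ) (seq : List Batch) {i : ℕ} (hi : i < seq.length) :
    algOrientation T s (seq.take (i + 1)) =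
      (algStep T s (algOrientation T s (seq.take i)) seq[i]).1 := by
  rw [List.take_succ_eq_append_getElem hi, algOrientation, algRun_append_singleton]

theorem algFlips_take_succ (T s : ℕ) (seq : List Batch) {i : ℕ} (hi : i < seq.length) :
    algFlips T s (seq.take (i + 1)) = algFlips T s (seq.take i) +
      (algStep T s (algOrientation T s (seq.take i)) seq[i]).2 := by
  rw [List.take_succ_eq_append_getElem hi, algFlips, algRun_append_singleton]

theorem graphAfter_take_succ (seq : List Batch) {i : ℕ} (hi : i < seq.length) :
    graphAfter (seq.take (i + 1)) = seq[i].applyTo (graphAfter (seq.take i)) := by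
  rw [List.take_succ_eq_append_getElem hi, graphAfter, List.foldl_append]; rfl

theorem totalIns_take_succ (seq : List Batch) {i : ℕ} (hi : i < seq.length) :
    totalIns (seq.take (i + 1)) = totalIns (seq.take i) + seq[i].numIns := by
  rw [List.take_succ_eq_append_getElem hi, totalIns, List.map_append, List.sum_append]
  simp [totalIns]

theorem totalUpdates_take_succ (seq : List Batch) {i : ℕ} (hi : i < seq.length) :
    totalUpdates (seq.take (i + 1)) = totalUpdates (seq.take i) + seq[i].edges.length := by
  rw [List.take_succ_eq_append_getElem hi, totalUpdates, List.map_append, List.sum_append]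
  simp [totalUpdates]

theorem totalIns_le_totalUpdates (seq : List Batch) : totalIns seq ≤ totalUpdates seq := by
  refine List.sum_le_sum fun b _ => ?_
  cases b with
  | ins B => exact le_rfl
  | del B => exact Nat.zero_le _

namespace ArboricityPreserving

variable {n c : ℕ} {seq : List Batch}

theorem simpleBelow (h : ArboricityPreserving n c seq) (i : ℕ) (hi : i ≤ seq.length) :
    SimpleBelow n (graphAfter (seq.take i)) := by
  induction i with
  | zero => intro e he; simp [graphAfter] at he
  | succ i ih =>
    rw [graphAfter_take_succ seq hi]
    exact (ih (by omega)).applyTo (h.1 i hi)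

theorem shrinks (h : ArboricityPreserving n c seq) {ε : ℝ} (hε : 0 < ε) {q : ℕ}
    (hq : 2 + ε ≤ q * ε) (i : ℕ) (hi : i ≤ seq.length) (A : Finset (ℕ × ℕ))
    (hA : ∀ e ∈ A, undirect e ∈ graphAfter (seq.take i)) : Shrinks ⌊(2 + ε) * c⌋₊ q A :=
  shrinks_of_arboricity_le hε (fun e he => (h.simpleBelow i hi e he).1)
    (fun e he => (h.simpleBelow i hi e he).2) (h.2 i hi) hq hA

variable {T s q : ℕ}

theorem isOrientation (h : ArboricityPreserving n c seq)
    (hs : ∀ i ≤ seq.length, ∀ A : Finset (ℕ × ℕ),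
      (∀ e ∈ A, undirect e ∈ graphAfter (seq.take i)) → Shrinks s q A)
    (i : ℕ) (hi : i ≤ seq.length) :
    IsOrientation (algOrientation T s (seq.take i)) (graphAfter (seq.take i)) := by
  induction i with
  | zero => exact ⟨rfl, by simp [algOrientation, algRun]⟩
  | succ i ih =>
    rw [algOrientation_take_succ T s seq hi, graphAfter_take_succ seq hi]
    refine isOrientation_algStep (h.simpleBelow i (by omega)) (ih (by omega)) (h.1 i hi)
      fun A hA => hs (i + 1) hi A ?_
    rwa [graphAfter_take_succ seq hi]

/-- The expected cost of the program on the batches from the `i`-th on. -/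
theorem spec_updateAll {p K k : ℕ} (h : ArboricityPreserving n c seq)
    (hs : ∀ i ≤ seq.length, ∀ A : Finset (ℕ × ℕ),
      (∀ e ∈ A, undirect e ∈ graphAfter (seq.take i)) → Shrinks s q A)
    (hp : p.Prime) (hnp : n ≤ p) (hq : 1 ≤ q) (hK : Pays K T s k) (j : ℕ) :
    ∀ (i : ℕ) (m : Mem), i + j = seq.length →
      Holds n m (algOrientation T s (seq.take i)) (highSet T n (algOrientation T s (seq.take i))) →
      ∃ w, w + (42 + 140 * (q * K)) * (totalUpdates (seq.take i) + algFlips T s (seq.take i)) ≤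
          (42 + 140 * (q * K)) * (totalUpdates seq + algFlips T s seq) ∧
        (Prog.updateAll p T s (seq.drop i)).Spec m
          (fun _ m' => m'.Stores (algOrientation T s seq)) w := by
  induction j with
  | zero =>
    intro i m hi hm
    have hi' : i = seq.length := by omega
    subst hi'
    rw [List.take_length] at hm ⊢
    rw [List.drop_length]
    exact ⟨0, by rw [zero_add], Prog.Spec.pure hm.stores⟩
  | succ j ih =>
    intro i m hij hm
    have hi : i < seq.length := by omega
    have hstep := Prog.spec_update (T := T) (s := s) hp hnp hq (h.simpleBelow i hi.le)
      (h.isOrientation (T := T) hs i hi.le) (h.1 i hi)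
      (fun A hA => hs (i + 1) hi A (by rwa [graphAfter_take_succ seq hi])) hm
    rw [← algOrientation_take_succ T s seq hi] at hstep
    -- the cost bound does not depend on the memory, so one bound serves all outcomes
    let w := (42 + 140 * (q * K)) * (totalUpdates seq + algFlips T s seq) -
      (42 + 140 * (q * K)) * (totalUpdates (seq.take (i + 1)) + algFlips T s (seq.take (i + 1)))
    -- some outcome exists, and the induction hypothesis for it shows that the subtraction in `w` does
    -- not truncate
    have hne : ∃ m', Holds n m' (algOrientation T s (seq.take (i + 1)))
        (highSet T n (algOrientation T s (seq.take (i + 1)))) := by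
      obtain ⟨x, hx⟩ := ((Prog.update p T s seq[i]).run m).support_nonempty
      exact ⟨_, hstep.1 x hx⟩
    have hle : (42 + 140 * (q * K)) * (totalUpdates (seq.take (i + 1)) +
        algFlips T s (seq.take (i + 1))) ≤
        (42 + 140 * (q * K)) * (totalUpdates seq + algFlips T s seq) := by
      obtain ⟨m', hm'⟩ := hne
      obtain ⟨w', hw', -⟩ := ih (i + 1) m' (by omega) hm'
      omega
    refine ⟨(42 * seq[i].edges.length +
      140 * (q * staticSize T (algOrientation T s (seq.take i)) seq[i])) + w, ?_, ?_⟩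
    · have h1 := staticSize_le hK (algOrientation T s (seq.take i)) seq[i]
      have h2 := Nat.mul_le_mul_left (140 * q) h1
      have h3 : (42 + 140 * (q * K)) * (totalUpdates (seq.take (i + 1)) +
          algFlips T s (seq.take (i + 1))) =
          (42 + 140 * (q * K)) * (totalUpdates (seq.take i) + algFlips T s (seq.take i)) +
          (42 * seq[i].edges.length + 140 * q * K * seq[i].edges.length +
            42 * (algStep T s (algOrientation T s (seq.take i)) seq[i]).2 +
            140 * q * (K * (algStep T s (algOrientation T s (seq.take i)) seq[i]).2)) := by
        rw [totalUpdates_take_succ seq hi, algFlips_take_succ T s seq hi]; ring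
      have h4 : 140 * (q * staticSize T (algOrientation T s (seq.take i)) seq[i]) =
          140 * q * staticSize T (algOrientation T s (seq.take i)) seq[i] := by ring
      have h5 : 0 ≤ 140 * q * K * seq[i].edges.length := Nat.zero_le _
      simp only [w]
      omega
    · rw [List.drop_eq_getElem_cons hi]
      refine Prog.Spec.bind hstep ?_
      rintro - m' hm'
      obtain ⟨w', hw', hspec⟩ := ih (i + 1) m' (by omega) hm'
      exact hspec.mono_cost (by simp only [w]; omega)

end ArboricityPreserving

namespace Strategy

variable {n c : ℕ} {seq : List Batch}

/-- Every update and every flip takes a unit of work. -/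
theorem totalUpdates_add_flips_le_work {k : ℝ} (h : ArboricityPreserving n c seq)
    (S : Strategy seq k) : totalUpdates seq + S.flips ≤ S.work := by
  have key : ∀ i ≤ seq.length, totalUpdates (seq.take i) + ∑ j ∈ Finset.range i,
      disagreements (S.state (S.time j)) (S.state (S.time (j + 1))) ≤ S.time i := by
    intro i
    induction i with
    | zero => intro _; simp [totalUpdates]
    | succ i ih =>
      intro hi
      have h1 := ih (by omega)
      have hle : S.time i ≤ S.time (i + 1) := S.time_mono (Nat.le_succ i)
      have h2 := Batch.length_add_flips_le S.unit_work hle (h.1 i hi) (S.orients i (by omega))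
        (graphAfter_take_succ seq hi ▸ S.orients (i + 1) hi)
      rw [totalUpdates_take_succ seq hi, Finset.sum_range_succ]
      omega
  have := key seq.length le_rfl
  rwa [List.take_length] at this

theorem algFlips_le {K T s k q : ℕ} {κ : ℝ} (hK : Pays K T s k) (hκ : ⌊κ⌋₊ ≤ k)
    (h : ArboricityPreserving n c seq)
    (hs : ∀ i ≤ seq.length, ∀ A : Finset (ℕ × ℕ),
      (∀ e ∈ A, undirect e ∈ graphAfter (seq.take i)) → Shrinks s q A)
    (S : Strategy seq κ) : algFlips T s seq ≤ K * (totalIns seq + S.flips) := by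
  have key : ∀ i ≤ seq.length, algFlips T s (seq.take i) +
      K * disagreements (algOrientation T s (seq.take i)) (S.state (S.time i)) ≤
      K * (totalIns (seq.take i) + ∑ j ∈ Finset.range i,
        disagreements (S.state (S.time j)) (S.state (S.time (j + 1)))) := by
    intro i
    induction i with
    | zero => intro _; simp [algFlips, algOrientation, algRun, disagreements]
    | succ i ih =>
      intro hi
      have h1 := ih (by omega)
      have h2 := flips_add_disagreements_le hK (h.1 i hi)
        (h.isOrientation (T := T) hs i (by omega)) (S.orients i (by omega))
        (graphAfter_take_succ seq hi ▸ S.orients (i + 1) hi)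
        (fun v => (Nat.le_floor (S.bounded (i + 1) hi v)).trans hκ)
      rw [← algOrientation_take_succ T s seq hi] at h2
      rw [algFlips_take_succ T s seq hi, totalIns_take_succ seq hi, Finset.sum_range_succ]
      simp only [mul_add] at h1 h2 ⊢
      omega
  have := key seq.length le_rfl
  rw [List.take_length] at this
  exact (Nat.le_add_right _ _).trans this

end Strategy

theorem outdeg_algOrientation_le (T s : ℕ) (seq : List Batch) (v : ℕ) :
    outdeg (algOrientation T s seq) v ≤ T + s := by
  induction seq using List.reverseRecOn with
  | nil => simp [algOrientation, algRun, outdeg]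
  | append_singleton seq b ih =>
    rw [algOrientation, algRun_append_singleton]
    cases b with
    | ins B => exact outdeg_replace_highEdges_le T s _ v
    | del B => exact (outdeg_mono (Finset.filter_subset _ _) v).trans ih

theorem theorem2 (α ε θ : ℝ) (hα : 0 < α) (hε : 0 < ε) (hε₂ : ε ≤ 2) (hθ : 2 * α + 2 + ε < θ) :
    ∃ K : ℕ, ∀ (n c : ℕ) (seq : List Batch), ArboricityPreserving n c seq →
      let T : ℕ := ⌊θ * c⌋₊
      let s : ℕ := ⌊(2 + ε) * c⌋₊
      let program : Prog Unit := Prog.updateAll (hashPrime n) T s seq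
      (IsOrientation (algOrientation T s seq) (graphAfter seq) ∧
        ∀ v, (outdeg (algOrientation T s seq) v : ℝ) ≤ (θ + 2 + ε) * c) ∧
      (∀ x ∈ (program.run (Mem.init n)).support, x.2.1.Stores (algOrientation T s seq)) ∧
      program.expectedWork (Mem.init n) ≤
        ((K * (totalUpdates seq + algFlips T s seq) : ℕ) : ENNReal) ∧
      ∀ S : Strategy seq (α * c),
        algFlips T s seq ≤ K * (totalIns seq + S.flips) ∧
        program.expectedWork (Mem.init n) ≤ ((K * S.work : ℕ) : ENNReal) := by
  obtain ⟨K₀, hK₀⟩ := exists_pays hα hε hθ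
  obtain ⟨q, hq⟩ : ∃ q : ℕ, (2 + ε) / ε ≤ q := exists_nat_ge _
  rw [div_le_iff₀ hε] at hq
  have hq1 : 1 ≤ q := by
    rcases Nat.eq_zero_or_pos q with rfl | h
    · exfalso; push_cast at hq; linarith
    · exact h
  obtain ⟨C, hC⟩ : ∃ C, C = 42 + 140 * (q * K₀) := ⟨_, rfl⟩
  refine ⟨C * (1 + K₀) + K₀, fun n c seq h => ?_⟩
  intro T s program
  have hs := h.shrinks hε hq
  have hpays : Pays K₀ T s ⌊α * c⌋₊ := hK₀ c
  obtain ⟨hnp, hp⟩ := Nat.find_spec (Nat.exists_infinite_primes n)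
  obtain ⟨w, hw, hspec⟩ := h.spec_updateAll (T := T) hs hp hnp hq1 hpays seq.length 0 (Mem.init n)
    (zero_add _) (holds_init T n)
  rw [← hC] at hw
  have hw' : w ≤ C * (totalUpdates seq + algFlips T s seq) := (Nat.le_add_right _ _).trans hw
  refine ⟨⟨?_, fun v => ?_⟩, hspec.1, ?_, fun S => ?_⟩
  · have := h.isOrientation (T := T) hs seq.length le_rfl
    rwa [List.take_length] at this
  · have h1 : ((outdeg (algOrientation T s seq) v : ℕ) : ℝ) ≤ (T : ℝ) + s := by
      exact_mod_cast outdeg_algOrientation_le T s seq v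
    have hθ0 : 0 < θ := by linarith
    have h2 : (T : ℝ) ≤ θ * c := Nat.floor_le (by positivity)
    have h3 : (s : ℝ) ≤ (2 + ε) * c := Nat.floor_le (by positivity)
    linarith
  · refine hspec.2.trans (Nat.cast_le.2 (hw'.trans (Nat.mul_le_mul_right _ ?_)))
    calc C ≤ C * (1 + K₀) := Nat.le_mul_of_pos_right _ (by omega)
      _ ≤ _ := Nat.le_add_right _ _
  · have hflips := S.algFlips_le hpays le_rfl h hs
    have hwork := S.totalUpdates_add_flips_le_work h
    have hins := totalIns_le_totalUpdates seq
    refine ⟨hflips.trans (Nat.mul_le_mul_right _ (Nat.le_add_left _ _)), ?_⟩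
    refine hspec.2.trans (Nat.cast_le.2 (hw'.trans ?_))
    calc C * (totalUpdates seq + algFlips T s seq)
        ≤ C * (S.work + K₀ * S.work) := by
          refine Nat.mul_le_mul_left C (add_le_add (by omega) (hflips.trans ?_))
          exact Nat.mul_le_mul_left K₀ (by omega)
      _ = C * (1 + K₀) * S.work := by ring
      _ ≤ (C * (1 + K₀) + K₀) * S.work := Nat.mul_le_mul_right _ (Nat.le_add_right _ _)
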